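/- Let $\Omega\subset\mathbb R^2$ be a bounded polygonal domain (open, connected, equal to the interior of its closure; this includes every polygonal domain with Lipschitz boundary), let $\alpha\in[0,1]$ and let $u(x_1,x_2)=x_1^2+x_2^2$. For a conforming triangulation $\mathcal T_h$ of $\overline\Omega$ let $h$ be the maximal diameter of its elements and let $X_h$ be the space of continuous functions on $\overline\Omega$ that are affine on every element. A (straight) band in $\mathcal T_h$ is a union of elements $\mathcal B=\bigcup_{i=0}^N K_i\cup\bigcup_{i=1}^N\tilde K_i$, $N\ge 1$, of the following form: $P_0,\dots,P_{N+1}$ are consecutive points on a line, $Q_0,\dots,Q_N$ lie strictly on one side of that line, $K_i$ is the triangle $P_iQ_iP_{i+1}$ with maximum angle $\alpha_i$ attained at $Q_i$, and $\tilde K_i$ is the triangle $Q_{i-1}P_iQ_i$ with maximum angle $\tilde\alpha_i$ attained at $P_i$. Its length is $L=\sum_{i=0}^N|P_{i+1}-P_i|$. For constants $C_K,C_\alpha$ consider the assumptions $$|\tilde K_i|\le C_K|K_i|,\qquad |\tilde K_i|\le C_K|K_{i-1}|,\qquad \sin(\pi-\alpha_{i-1})\le C_\alpha\sin(\pi-\tilde\alpha_i)\qquad(i=1,\dots,N).\tag{1}$$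 There is a function $C_L:(0,\infty)\to(0,\infty)$, depending only on $\Omega$ and $\alpha$, with $C_L(s)\to0$ as $s\to0^+$, such that for every $C_u>0$ the following hold. (a) For all $C_K,C_\alpha$ there is a constant $C>0$, depending only on $\Omega,\alpha,C_u,C_K,C_\alpha$, such that for every conforming triangulation $\mathcal T_h$ of $\overline\Omega$ for which some $U\in X_h$ satisfies the error estimate $$|u-U|_{H^1(\Omega)}\le C_u h^\alpha,\tag{2}$$ every band in $\mathcal T_h$ that satisfies (1) and $L\ge C_L(C_u)\,h^{2\alpha/5}$ also satisfies $$\min_{1\le i\le N}\frac1{\sin(\pi-\tilde\alpha_i)}\;\min_{1\le i\le N}|\tilde K_i|^{1/2}\;L\,N^{-1/2}\le C h^\alpha .$$ (b) There is a constant $C>0$, depending only on $\Omega,\alpha,C_u$, such that for every conforming triangulation $\mathcal T_h$ of $\overline\Omega$ for which some $U\in X_h$ satisfies (2), every band in $\mathcal T_h$ with $L\ge C_L(C_u)\,h^{2\alpha/5}$ that consists of congruent isosceles triangles with base $h$ and height $\bar h$ (that is, $P_i=P_0+ih\,g$ and $Q_i=P_i+\tfrac h2g+\bar h\,n$ with orthonormal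 $g,n$) satisfies $\bar h\ge C\,h^{4-2\alpha}L$. -/

import Mathlib

open MeasureTheory Filter Topology

noncomputable section

namespace FEM

/-- The Euclidean plane `ℝ²`. -/
abbrev Plane := EuclideanSpace ℝ (Fin 2)

/-- A finite conforming triangulation of `closure Ω`. An element is recorded by the set of its three
vertices; the closed triangle itself is the convex hull of that set. Two elements meet exactly in
the convex hull of their common vertices, i.e. they are disjoint, or share one vertex, or share one
full edge, or coincide. -/
structure Triangulation (Ω : Set Plane) where
  elements : Set (Set Plane)
  finite : elements.Finite
  nondegenerate : ∀ s ∈ elements, ∃ a b c : Plane, AffineIndependent ℝ ![a, b, c] ∧ s = {a, b, c}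
  conforming : ∀ s ∈ elements, ∀ t ∈ elements,
    convexHull ℝ s ∩ convexHull ℝ t = convexHull ℝ (s ∩ t)
  cover : ⋃ s ∈ elements, convexHull ℝ s = closure Ω

/-- The mesh size `h`: the largest diameter of an element. -/
def Triangulation.meshSize {Ω : Set Plane} (T : Triangulation Ω) : ℝ :=
  sSup ((fun s : Set Plane => Metric.diam (convexHull ℝ s)) '' T.elements)

/-- The finite element space `X_h`: functions that are continuous on `closure Ω` and affine on every
element (values outside `closure Ω` play no role). -/
def Triangulation.feSpace {Ω : Set Plane} (T : Triangulation Ω) : Set (Plane → ℝ) :=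
  {U | ContinuousOn U (closure Ω) ∧
    ∀ s ∈ T.elements, ∃ A : Plane →ᵃ[ℝ] ℝ, ∀ x ∈ convexHull ℝ s, U x = A x}

/-- The seminorm `|f|_{H¹(Ω)} = (∫_Ω |∇f|²)^{1/2}`. It is used only for `f = u - U` with `u` smooth
and `U ∈ X_h`; such an `f` is Lipschitz on each element and smooth off the (null) union of the
element edges, so its classical gradient there is its weak gradient. -/
def h1Seminorm (Ω : Set Plane) (f : Plane → ℝ) : ℝ :=
  √(∫ x in Ω, ‖gradient f x‖ ^ 2)

/-- The quadratic function `u(x₁, x₂) = x₁² + x₂²`. -/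
def quadratic (x : Plane) : ℝ := x 0 ^ 2 + x 1 ^ 2

/-- The area of the triangle with the given vertex set. -/
def area (s : Set Plane) : ℝ := (volume (convexHull ℝ s)).toReal

/-- The maximum angle of the triangle `A B C`. -/
def maxAngle (A B C : Plane) : ℝ :=
  max (EuclideanGeometry.angle B A C)
    (max (EuclideanGeometry.angle A B C) (EuclideanGeometry.angle A C B))

/-- A straight band of elements of `T`. The points `P 0, …, P (N+1)` follow one another on a line,
the points `Q 0, …, Q N` lie strictly on one side of that line, and the elements of the band are
`K i = P i, Q i, P (i+1)` for `i = 0, …, N`, with maximum angle at `Q i`, and, alternating with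
these, `K̃ i = Q (i-1), P i, Q i` for `i = 1, …, N`, with maximum angle at `P i`.
Thus `K (i-1), K̃ i` share the edge `Q (i-1), P i` and `K̃ i, K i` share the edge `P i, Q i`. In the
code the index `i : Fin N` of `K̃` is shifted by one. -/
structure Band {Ω : Set Plane} (T : Triangulation Ω) (N : ℕ) where
  P : Fin (N + 2) → Plane
  Q : Fin (N + 1) → Plane
  straight : ∃ g : Plane, ‖g‖ = 1 ∧ ∃ t : Fin (N + 2) → ℝ, StrictMono t ∧
    ∀ i, P i = P 0 + t i • g
  oneSide : ∀ i j, (affineSpan ℝ (Set.range P)).SSameSide (Q i) (Q j)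
  mem_K : ∀ i : Fin (N + 1), {P i.castSucc, Q i, P i.succ} ∈ T.elements
  mem_Ktilde : ∀ i : Fin N, {Q i.castSucc, P i.succ.castSucc, Q i.succ} ∈ T.elements
  maxAngle_K : ∀ i : Fin (N + 1),
    maxAngle (P i.castSucc) (Q i) (P i.succ) =
      EuclideanGeometry.angle (P i.castSucc) (Q i) (P i.succ)
  maxAngle_Ktilde : ∀ i : Fin N,
    maxAngle (Q i.castSucc) (P i.succ.castSucc) (Q i.succ) =
      EuclideanGeometry.angle (Q i.castSucc) (P i.succ.castSucc) (Q i.succ)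

namespace Band

variable {Ω : Set Plane} {T : Triangulation Ω} {N : ℕ} (B : Band T N)

/-- The vertices of `K i`, `i = 0, …, N`. -/
def K (i : Fin (N + 1)) : Set Plane := {B.P i.castSucc, B.Q i, B.P i.succ}

/-- The vertices of `K̃ (i+1)`, `i = 0, …, N-1`: the element between `K i` and `K (i+1)`. -/
def Ktilde (i : Fin N) : Set Plane := {B.Q i.castSucc, B.P i.succ.castSucc, B.Q i.succ}

/-- The maximum angle of `K i`. -/
def alpha (i : Fin (N + 1)) : ℝ := maxAngle (B.P i.castSucc) (B.Q i) (B.P i.succ)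

/-- The maximum angle of `K̃ (i+1)`. -/
def alphaTilde (i : Fin N) : ℝ :=
  maxAngle (B.Q i.castSucc) (B.P i.succ.castSucc) (B.Q i.succ)

/-- The length of `Γ`, the union of the longest edges of the `K i`. -/
def length : ℝ := ∑ i : Fin (N + 1), dist (B.P i.castSucc) (B.P i.succ)

/-- The geometric comparability assumptions on a band. -/
def Comparable (C_K C_α : ℝ) : Prop :=
  ∀ i : Fin N,
    area (B.Ktilde i) ≤ C_K * area (B.K i.succ) ∧
    area (B.Ktilde i) ≤ C_K * area (B.K i.castSucc) ∧
    Real.sin (Real.pi - B.alpha i.castSucc) ≤ C_α * Real.sin (Real.pi - B.alphaTilde i)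

/-- The band consists of congruent isosceles triangles with base `b` and height `hbar`. -/
def IsRegularIsosceles (b hbar : ℝ) : Prop :=
  0 < hbar ∧ ∃ g n : Plane, ‖g‖ = 1 ∧ ‖n‖ = 1 ∧ inner ℝ g n = 0 ∧
    (∀ i, B.P i = B.P 0 + ((i : ℕ) * b : ℝ) • g) ∧
    ∀ i : Fin (N + 1), B.Q i = B.P i.castSucc + (b / 2) • g + hbar • n

end Band

end FEM

end

/-!
Along a line the second difference of `u` with step `δ` is `2 δ²`. If the tangential derivative of
`U` varies by at most `δ / 2` there, then the second difference of the error `u - U` is at least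
`δ²`. Fix one triangulation once and for all: a segment of length `L` has a part of comparable
length inside one of its elements, and some vertex of this element is far from the line. Joining
points of the line through a point displaced towards that vertex, and integrating `∇ (u - U)`
along the two legs, bounds `L ^ 5` by a multiple of `|u - U|²`. So the tangential derivative of
`U` along a band longer than the threshold has total variation at least of order `L`.

Conversely, the jump of `∇ U` across an edge is orthogonal to that edge, and the two edges of `K̃ i`
issuing from `P i` make angles at most `π - α̃ i` with the direction of the band, so the tangential
component of the jump is at most `2 sin (π - α̃ i)` times the jump. The jumps are controlled in mean
square by the error, and Cauchy-Schwarz over the `N` elements gives the estimate.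
-/

namespace FEM

/-! ### The cross product and the area of a triangle -/

/-- The cross product of two plane vectors, as a bilinear form. -/
def cross : Plane →ₗ[ℝ] Plane →ₗ[ℝ] ℝ :=
  LinearMap.mk₂ ℝ (fun v w => v 0 * w 1 - v 1 * w 0)
    (fun u v w => by simp only [PiLp.add_apply]; ring)
    (fun c v w => by simp only [PiLp.smul_apply, smul_eq_mul]; ring)
    (fun u v w => by simp only [PiLp.add_apply]; ring)
    (fun c v w => by simp only [PiLp.smul_apply, smul_eq_mul]; ring)

theorem cross_apply (v w : Plane) : cross v w = v 0 * w 1 - v 1 * w 0 := rfl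

@[simp]
theorem cross_self (v : Plane) : cross v v = 0 := by
  rw [cross_apply]; ring

theorem cross_comm (v w : Plane) : cross v w = -cross w v := by
  simp only [cross_apply]; ring

theorem inner_eq (v w : Plane) : inner ℝ v w = v 0 * w 0 + v 1 * w 1 := by
  simp [PiLp.inner_apply, Fin.sum_univ_two, mul_comm]

theorem norm_sq_eq (v : Plane) : ‖v‖ ^ 2 = v 0 ^ 2 + v 1 ^ 2 := by
  rw [EuclideanSpace.real_norm_sq_eq, Fin.sum_univ_two]

theorem cross_sq_add_inner_sq (v w : Plane) :
    cross v w ^ 2 + inner ℝ v w ^ 2 = ‖v‖ ^ 2 * ‖w‖ ^ 2 := by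
  rw [cross_apply, inner_eq, norm_sq_eq, norm_sq_eq]; ring

theorem abs_cross_le (v w : Plane) : |cross v w| ≤ ‖v‖ * ‖w‖ := by
  refine abs_le_of_sq_le_sq ?_ (by positivity)
  rw [mul_pow, ← cross_sq_add_inner_sq]
  exact le_add_of_nonneg_right (sq_nonneg _)

theorem abs_cross_eq_one_of_orthonormal {g n : Plane} (hg : ‖g‖ = 1) (hn : ‖n‖ = 1)
    (hgn : inner ℝ g n = 0) : |cross g n| = 1 := by
  have hsum := cross_sq_add_inner_sq g n
  rw [hg, hn, hgn] at hsum
  rw [← sq_eq_sq₀ (abs_nonneg _) zero_le_one, sq_abs]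
  linarith

theorem cross_smul_add_smul (g n : Plane) (a b c d : ℝ) :
    cross (a • g + b • n) (c • g + d • n) = (a * d - b * c) * cross g n := by
  simp only [cross_apply, PiLp.add_apply, PiLp.smul_apply, smul_eq_mul]
  ring

/-- The linear map sending the standard basis of the plane to `v, w`. -/
def frameMap (v w : Plane) : Plane →ₗ[ℝ] Plane where
  toFun x := x 0 • v + x 1 • w
  map_add' x y := by simp only [PiLp.add_apply, add_smul]; abel
  map_smul' c x := by simp [mul_smul]

theorem frameMap_apply (v w x : Plane) : frameMap v w x = x 0 • v + x 1 • w := rfl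

theorem det_frameMap (v w : Plane) : LinearMap.det (frameMap v w) = cross v w := by
  rw [← LinearMap.det_toMatrix (EuclideanSpace.basisFun (Fin 2) ℝ).toBasis, Matrix.det_fin_two]
  simp only [LinearMap.toMatrix_apply, OrthonormalBasis.coe_toBasis,
    OrthonormalBasis.coe_toBasis_repr_apply, EuclideanSpace.basisFun_apply,
    EuclideanSpace.basisFun_repr, frameMap_apply, cross_apply]
  simp [mul_comm]

theorem lintegral_frame (p : Plane) {g d : Plane} (hJ : cross g d ≠ 0) {Ψ : Plane → ENNReal}
    (hΨ : Measurable Ψ) :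
    ∫⁻ t : ℝ, ∫⁻ s : ℝ, Ψ (p + t • g + s • d) =
      ENNReal.ofReal |(cross g d)⁻¹| * ∫⁻ x, Ψ x := by
  have hplane : ∫⁻ t : ℝ, ∫⁻ s : ℝ, Ψ (p + t • g + s • d) =
      ∫⁻ x : Plane, Ψ (p + frameMap g d x) := by
    have hpair := (volume_preserving_finTwoArrow ℝ).lintegral_comp (f := fun q : ℝ × ℝ =>
      Ψ (p + q.1 • g + q.2 • d)) (by fun_prop)
    have htoLp := (PiLp.volume_preserving_ofLp (Fin 2)).lintegral_comp (f := fun q : Fin 2 → ℝ =>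
      Ψ (p + q 0 • g + q 1 • d)) (by fun_prop)
    rw [Measure.volume_eq_prod, lintegral_prod _ (by fun_prop)] at hpair
    rw [← hpair]
    simp only [MeasurableEquiv.finTwoArrow_apply]
    rw [← htoLp]
    simp [frameMap_apply, add_assoc]
  rw [hplane, ← lintegral_map (f := fun x => Ψ (p + x)) (hΨ.comp (measurable_const_add p))
      (LinearMap.continuous_of_finiteDimensional (frameMap g d)).measurable,
    Measure.map_linearMap_addHaar_eq_smul_addHaar volume (by rwa [det_frameMap]),
    lintegral_smul_measure, det_frameMap, lintegral_add_left_eq_self Ψ p, smul_eq_mul]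

theorem lintegral_parallelogram_le {p g d : Plane} (hJ : cross g d ≠ 0) {K : Set Plane}
    (hK : MeasurableSet K) {I J : Set ℝ} (hI : MeasurableSet I) (hJm : MeasurableSet J)
    (hmem : ∀ t ∈ I, ∀ s ∈ J, p + t • g + s • d ∈ K)
    {Φ : Plane → ENNReal} (hΦ : Measurable Φ) :
    ∫⁻ t in I, ∫⁻ s in J, Φ (p + t • g + s • d) ≤
      ENNReal.ofReal |(cross g d)⁻¹| * ∫⁻ x in K, Φ x := by
  rw [← lintegral_indicator hK, ← lintegral_frame p hJ (hΦ.indicator hK)]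
  refine (setLIntegral_mono' hI fun t ht => ?_).trans (setLIntegral_le_lintegral I _)
  refine (setLIntegral_mono' hJm fun s hs => ?_).trans (setLIntegral_le_lintegral J _)
  rw [Set.indicator_of_mem (hmem t ht s hs)]

theorem area_nonneg (s : Set Plane) : 0 ≤ area s := ENNReal.toReal_nonneg

/-- The vertices of the unit triangle, of which every triangle is an affine image. -/
def unitTriangle : Set Plane := {0, EuclideanSpace.single 0 1, EuclideanSpace.single 1 1}

theorem mem_convexHull_unitTriangle {x : Plane} :
    x ∈ convexHull ℝ unitTriangle ↔ 0 ≤ x 0 ∧ 0 ≤ x 1 ∧ x 0 + x 1 ≤ 1 := by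
  constructor
  · have hconvex : Convex ℝ {x : Plane | 0 ≤ x 0 ∧ 0 ≤ x 1 ∧ x 0 + x 1 ≤ 1} := by
      rintro x ⟨hx0, hx1, hx⟩ y ⟨hy0, hy1, hy⟩ r s hr hs hrs
      refine ⟨?_, ?_, ?_⟩ <;> simp only [PiLp.add_apply, PiLp.smul_apply, smul_eq_mul]
      · positivity
      · positivity
      · nlinarith
    refine fun hx => convexHull_min ?_ hconvex hx
    rintro y (rfl | rfl | rfl) <;> simp
  · rintro ⟨h0, h1, h⟩
    refine mem_convexHull_of_exists_fintype ![1 - x 0 - x 1, x 0, x 1]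
      ![0, EuclideanSpace.single 0 1, EuclideanSpace.single 1 1] ?_ ?_ ?_ ?_
    · simp only [Fin.forall_fin_succ, Matrix.cons_val]
      exact ⟨by linarith, h0, h1, by simp⟩
    · simp only [Fin.sum_univ_three, Matrix.cons_val]
      ring
    · simp [Fin.forall_fin_succ, unitTriangle]
    · ext i
      fin_cases i <;> simp [Fin.sum_univ_three]

theorem volume_slice_unitTriangle (t : ℝ) :
    volume {s : ℝ | (0 : Plane) + t • EuclideanSpace.single 0 1 + s • EuclideanSpace.single 1 1 ∈
      convexHull ℝ unitTriangle} =
      (Set.Icc 0 1).indicator (fun t => ENNReal.ofReal (1 - t)) t := by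
  have hslice : {s : ℝ | (0 : Plane) + t • EuclideanSpace.single 0 1 +
      s • EuclideanSpace.single 1 1 ∈ convexHull ℝ unitTriangle} =
      if t ∈ Set.Icc (0 : ℝ) 1 then Set.Icc 0 (1 - t) else ∅ := by
    ext s
    simp only [mem_convexHull_unitTriangle, Set.mem_ofPred_eq, Set.mem_Icc, apply_ite (s ∈ ·),
      Set.mem_empty_iff_false, if_false_right]
    simp only [zero_add, PiLp.add_apply, PiLp.smul_apply, PiLp.single_apply, smul_eq_mul]
    grind
  rw [hslice, Set.indicator_apply]
  split_ifs <;> simp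

theorem area_unitTriangle : area unitTriangle = 1 / 2 := by
  have hmeas : MeasurableSet (convexHull ℝ unitTriangle) :=
    (Set.Finite.isCompact_convexHull (𝕜 := ℝ) (by simp [unitTriangle])).measurableSet
  have hcross : cross (EuclideanSpace.single 0 1) (EuclideanSpace.single 1 1) = 1 := by
    simp [cross_apply]
  have hvolume := lintegral_frame 0 (hcross ▸ one_ne_zero)
    ((measurable_one (α := ENNReal)).indicator hmeas)
  have hslice (t : ℝ) : ∫⁻ s : ℝ, (convexHull ℝ unitTriangle).indicator 1
      (0 + t • EuclideanSpace.single 0 1 + s • EuclideanSpace.single 1 1) =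
      (Set.Icc 0 1).indicator (fun t => ENNReal.ofReal (1 - t)) t := by
    rw [← volume_slice_unitTriangle]
    exact lintegral_indicator_one (hmeas.preimage (by fun_prop))
  have hintegral : ∫ t in (0 : ℝ)..1, (1 - t) = 1 / 2 := by
    rw [intervalIntegral.integral_sub (by simp) (by simp), integral_id]
    norm_num
  simp_rw [hslice] at hvolume
  rw [hcross, lintegral_indicator_one hmeas, lintegral_indicator measurableSet_Icc,
    ← ofReal_integral_eq_lintegral_ofReal] at hvolume
  · rw [integral_Icc_eq_integral_Ioc, ← intervalIntegral.integral_of_le zero_le_one,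
      hintegral] at hvolume
    rw [inv_one, abs_one, ENNReal.ofReal_one, one_mul] at hvolume
    rw [area, ← hvolume, ENNReal.toReal_ofReal one_half_pos.le]
  · exact (continuous_const.sub continuous_id).continuousOn.integrableOn_Icc
  · filter_upwards [ae_restrict_mem measurableSet_Icc] with t ht
    simpa using ht.2

open scoped Pointwise in
theorem convexHull_triangle_eq_image (a b c : Plane) :
    convexHull ℝ {a, b, c} = a +ᵥ frameMap (b - a) (c - a) '' convexHull ℝ unitTriangle := by
  rw [(frameMap (b - a) (c - a)).image_convexHull, ← convexHull_vadd]
  simp [unitTriangle, Set.image_insert_eq, frameMap_apply, ← Set.image_vadd]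

open scoped Pointwise in
theorem area_eq (a b c : Plane) : area {a, b, c} = |cross (b - a) (c - a)| / 2 := by
  rw [area, convexHull_triangle_eq_image, measure_vadd, Measure.addHaar_image_linearMap,
    det_frameMap, ENNReal.toReal_mul, ENNReal.toReal_ofReal (abs_nonneg _), ← area,
    area_unitTriangle, mul_one_div]

/-! ### Piecewise gradients on a triangulation -/

namespace Triangulation

variable {Ω : Set Plane} (T : Triangulation Ω)

theorem exists_affineBasis {s : Set Plane} (hs : s ∈ T.elements) :
    ∃ b : AffineBasis (Fin 3) ℝ Plane, Set.range b = s := by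
  obtain ⟨a, b, c, hind, rfl⟩ := T.nondegenerate s hs
  refine ⟨⟨![a, b, c], hind, ?_⟩, ?_⟩
  · rw [hind.affineSpan_eq_top_iff_card_eq_finrank_add_one]
    simp
  · change Set.range ![a, b, c] = _
    simp only [Matrix.range_cons, Matrix.range_empty, Set.union_empty]
    rfl

theorem interior_nonempty {s : Set Plane} (hs : s ∈ T.elements) :
    (interior (convexHull ℝ s)).Nonempty := by
  obtain ⟨b, rfl⟩ := T.exists_affineBasis hs
  exact interior_convexHull_nonempty_iff_affineSpan_eq_top.2 b.tot

theorem isCompact_element {s : Set Plane} (hs : s ∈ T.elements) :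
    IsCompact (convexHull ℝ s) := by
  obtain ⟨b, rfl⟩ := T.exists_affineBasis hs
  exact (Set.finite_range b).isCompact_convexHull ℝ

theorem isCompact_closure (T : Triangulation Ω) : IsCompact (closure Ω) := by
  rw [← T.cover]
  exact T.finite.isCompact_biUnion fun s hs => T.isCompact_element hs

theorem area_pos {s : Set Plane} (hs : s ∈ T.elements) : 0 < area s :=
  ENNReal.toReal_pos (Measure.measure_pos_of_nonempty_interior _ (T.interior_nonempty hs)).ne'
    (T.isCompact_element hs).measure_ne_top

theorem element_subset {s : Set Plane} (hs : s ∈ T.elements) : convexHull ℝ s ⊆ closure Ω := by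
  rw [← T.cover]
  exact Set.subset_biUnion_of_mem (u := fun s => convexHull ℝ s) hs

theorem exists_mem_of_mem_closure {x : Plane} (hx : x ∈ closure Ω) :
    ∃ s ∈ T.elements, x ∈ convexHull ℝ s := by
  rw [← T.cover] at hx
  simpa only [Set.mem_iUnion, exists_prop] using hx

theorem interior_convexHull_inter_eq_empty {s t : Set Plane} (hs : s ∈ T.elements)
    (hst : ¬s ⊆ t) : interior (convexHull ℝ (s ∩ t)) = ∅ := by
  obtain ⟨v, hvs, hvt⟩ := Set.not_subset.1 hst
  obtain ⟨b, rfl⟩ := T.exists_affineBasis hs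
  obtain ⟨i, rfl⟩ := hvs
  by_contra hne
  have hspan := interior_convexHull_nonempty_iff_affineSpan_eq_top.1
    (Set.nonempty_iff_ne_empty.2 hne)
  have hvertex := b.ind.notMem_affineSpan_sdiff i Set.univ
  rw [Set.image_sdiff b.ind.injective, Set.image_univ, Set.image_singleton] at hvertex
  refine hvertex (affineSpan_mono ℝ ?_ (hspan ▸ AffineSubspace.mem_top ℝ Plane (b i)))
  rintro x ⟨hx, hxt⟩
  exact ⟨hx, fun h => hvt (h ▸ hxt)⟩

theorem pairwiseDisjoint_interior :
    T.elements.PairwiseDisjoint fun s => interior (convexHull ℝ s) := by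
  intro s hs t ht hst
  rw [Function.onFun, Set.disjoint_iff_inter_eq_empty, ← interior_inter, T.conforming s hs t ht]
  by_cases hsub : s ⊆ t
  · rw [Set.inter_comm]
    exact T.interior_convexHull_inter_eq_empty ht fun h => hst (hsub.antisymm h)
  · exact T.interior_convexHull_inter_eq_empty hs hsub

theorem exists_finite_edgeLines_element {s : Set Plane} (hs : s ∈ T.elements) :
    ∃ F : Set (Plane →ᵃ[ℝ] ℝ), F.Finite ∧ (∀ A ∈ F, A.linear ≠ 0) ∧
      ∀ x ∈ convexHull ℝ s, (∀ A ∈ F, A x ≠ 0) → x ∈ interior (convexHull ℝ s) := by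
  obtain ⟨b, rfl⟩ := T.exists_affineBasis hs
  refine ⟨Set.range b.coord, Set.finite_range _, ?_, fun x hx hne => ?_⟩
  · rintro _ ⟨i, rfl⟩ hlinear
    obtain ⟨j, hj⟩ := exists_ne i
    have hcoord := (b.coord i).linearMap_vsub (b i) (b j)
    rw [hlinear, AffineBasis.coord_apply_eq, AffineBasis.coord_apply_ne _ hj.symm] at hcoord
    simp at hcoord
  · rw [AffineBasis.interior_convexHull]
    rw [AffineBasis.convexHull_eq_nonneg_coord] at hx
    exact fun i => (hx i).lt_of_ne (hne _ ⟨i, rfl⟩).symm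

theorem exists_finite_edgeLines :
    ∃ F : Set (Plane →ᵃ[ℝ] ℝ), F.Finite ∧ (∀ A ∈ F, A.linear ≠ 0) ∧
      ∀ x ∈ closure Ω, (∀ A ∈ F, A x ≠ 0) → ∃ s ∈ T.elements, x ∈ interior (convexHull ℝ s) := by
  choose! F hfinite hlinear hinterior using fun s => T.exists_finite_edgeLines_element (s := s)
  refine ⟨⋃ s ∈ T.elements, F s, T.finite.biUnion hfinite, fun A hA => ?_, fun x hx hne => ?_⟩
  · obtain ⟨s, hs, hAs⟩ := Set.mem_iUnion₂.1 hA
    exact hlinear s hs A hAs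
  · obtain ⟨s, hs, hxs⟩ := T.exists_mem_of_mem_closure hx
    exact ⟨s, hs, hinterior s hs x hxs fun A hA => hne A (Set.mem_biUnion hs hA)⟩

theorem ae_mem_interior : ∀ᵐ x : Plane, x ∈ closure Ω →
    ∃ s ∈ T.elements, x ∈ interior (convexHull ℝ s) := by
  have hfrontier : ∀ᵐ x : Plane, ∀ s ∈ T.elements, x ∉ frontier (convexHull ℝ s) := by
    rw [ae_ball_iff T.finite.countable]
    exact fun s _ =>
      measure_eq_zero_iff_ae_notMem.1 ((convex_convexHull ℝ s).addHaar_frontier volume)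
  filter_upwards [hfrontier] with x hx hxΩ
  obtain ⟨s, hs, hxs⟩ := T.exists_mem_of_mem_closure hxΩ
  exact ⟨s, hs, by_contra fun hxi => hx s hs ⟨subset_closure hxs, hxi⟩⟩

theorem h1Seminorm_closure (T : Triangulation Ω) (hΩ : interior (closure Ω) ⊆ Ω)
    (f : Plane → ℝ) : h1Seminorm (closure Ω) f = h1Seminorm Ω f := by
  have hae : (closure Ω : Set Plane) =ᵐ[volume] Ω := by
    filter_upwards [T.ae_mem_interior] with x hx
    refine propext ⟨fun hxΩ => ?_, fun hxΩ => subset_closure hxΩ⟩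
    obtain ⟨s, hs, hxs⟩ := hx hxΩ
    exact hΩ (interior_mono (T.element_subset hs) hxs)
  rw [h1Seminorm, setIntegral_congr_set hae, h1Seminorm]

theorem dist_le_meshSize {s : Set Plane} (hs : s ∈ T.elements) {x y : Plane}
    (hx : x ∈ convexHull ℝ s) (hy : y ∈ convexHull ℝ s) : dist x y ≤ T.meshSize :=
  (Metric.dist_le_diam_of_mem (T.isCompact_element hs).isBounded hx hy).trans
    (le_csSup (T.finite.image _).bddAbove ⟨s, hs, rfl⟩)

theorem meshSize_le : T.meshSize ≤ Metric.diam (closure Ω) := by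
  refine Real.sSup_le ?_ Metric.diam_nonneg
  rintro _ ⟨s, hs, rfl⟩
  exact Metric.diam_mono (T.element_subset hs) T.isCompact_closure.isBounded

theorem meshSize_pos {s : Set Plane} (hs : s ∈ T.elements) : 0 < T.meshSize := by
  obtain ⟨b, rfl⟩ := T.exists_affineBasis hs
  have hne : b 0 ≠ b 1 := b.ind.injective.ne (by decide)
  exact (dist_pos.2 hne).trans_le (T.dist_le_meshSize hs
    (subset_convexHull ℝ _ ⟨0, rfl⟩) (subset_convexHull ℝ _ ⟨1, rfl⟩))

/-- The functions whose values along lines and whose classical gradients are tied together by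
`T`: continuous on `closure Ω`, differentiable inside every element, with bounded gradient. The
differences `u - U` with `U` in the finite element space are of this kind. -/
structure IsPiecewiseSmooth (f : Plane → ℝ) : Prop where
  continuousOn : ContinuousOn f (closure Ω)
  differentiableAt : ∀ s ∈ T.elements, ∀ x ∈ interior (convexHull ℝ s), DifferentiableAt ℝ f x
  bounded : ∃ M, ∀ s ∈ T.elements, ∀ x ∈ interior (convexHull ℝ s), ‖gradient f x‖ ≤ M

/-- `G s` is the gradient of the finite element function `U` on the element `s`. It is recorded
through increments, so that no derivative at the boundary of an element is involved. -/
structure IsElementGradient (U : Plane → ℝ) (G : Set Plane → Plane) : Prop where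
  continuousOn : ContinuousOn U (closure Ω)
  sub_eq : ∀ s ∈ T.elements, ∀ x ∈ convexHull ℝ s, ∀ y ∈ convexHull ℝ s,
    U y - U x = inner ℝ (G s) (y - x)

theorem exists_isElementGradient {U : Plane → ℝ} (hU : U ∈ T.feSpace) :
    ∃ G, T.IsElementGradient U G := by
  choose! A hA using hU.2
  refine ⟨fun s => (InnerProductSpace.toDual ℝ Plane).symm
    (LinearMap.toContinuousLinearMap (A s).linear), hU.1, fun s hs x hx y hy => ?_⟩
  rw [hA s hs x hx, hA s hs y hy, InnerProductSpace.toDual_symm_apply]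
  exact ((A s).linearMap_vsub y x).symm

end Triangulation

theorem measurable_gradient (f : Plane → ℝ) : Measurable (gradient f) :=
  (InnerProductSpace.toDual ℝ Plane).symm.continuous.measurable.comp (measurable_fderiv ℝ f)

theorem quadratic_eq (x : Plane) : quadratic x = ‖x‖ ^ 2 := (norm_sq_eq x).symm

theorem continuous_quadratic : Continuous quadratic := by
  rw [funext quadratic_eq]
  fun_prop

theorem hasGradientAt_quadratic (x : Plane) : HasGradientAt quadratic ((2 : ℝ) • x) x := by
  rw [hasGradientAt_iff_hasFDerivAt, funext quadratic_eq]
  exact (hasStrictFDerivAt_norm_sq x).hasFDerivAt.congr_fderiv (by ext y; simp)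

namespace Triangulation

variable {Ω : Set Plane} {T : Triangulation Ω} {f U : Plane → ℝ} {G : Set Plane → Plane}

theorem IsPiecewiseSmooth.integrableOn_gradient (hf : T.IsPiecewiseSmooth f) :
    IntegrableOn (fun x => ‖gradient f x‖ ^ 2) (closure Ω) := by
  obtain ⟨M, hM⟩ := hf.bounded
  refine Measure.integrableOn_of_bounded (M := M ^ 2) T.isCompact_closure.measure_ne_top
    ((measurable_gradient f).norm.pow_const 2).aestronglyMeasurable ?_
  rw [ae_restrict_iff' isClosed_closure.measurableSet]
  filter_upwards [T.ae_mem_interior] with x hx hxΩ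
  obtain ⟨s, hs, hxs⟩ := hx hxΩ
  rw [Real.norm_of_nonneg (by positivity)]
  exact pow_le_pow_left₀ (norm_nonneg _) (hM s hs x hxs) 2

theorem IsPiecewiseSmooth.h1Seminorm_sq (hf : T.IsPiecewiseSmooth f) :
    ENNReal.ofReal (h1Seminorm (closure Ω) f ^ 2) =
      ∫⁻ x in closure Ω, ENNReal.ofReal (‖gradient f x‖ ^ 2) := by
  rw [h1Seminorm, Real.sq_sqrt (integral_nonneg fun x => by positivity),
    ofReal_integral_eq_lintegral_ofReal hf.integrableOn_gradient
      (ae_of_all _ fun x => by positivity)]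

theorem IsElementGradient.hasGradientAt (hG : T.IsElementGradient U G) {s : Set Plane}
    (hs : s ∈ T.elements) {x : Plane} (hx : x ∈ interior (convexHull ℝ s)) :
    HasGradientAt (quadratic - U) ((2 : ℝ) • x - G s) x := by
  have hUlocal : U =ᶠ[𝓝 x] fun y => U x + inner ℝ (G s) (y - x) := by
    filter_upwards [isOpen_interior.mem_nhds hx] with y hy
    rw [← hG.sub_eq s hs x (interior_subset hx) y (interior_subset hy), add_sub_cancel]
  have hU : HasGradientAt U (G s) x := by
    rw [hasGradientAt_iff_hasFDerivAt]
    refine HasFDerivAt.congr_of_eventuallyEq ?_ hUlocal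
    exact (((innerSL ℝ (G s)).hasFDerivAt.comp x
      ((hasFDerivAt_id x).sub_const x)).const_add (U x))
  rw [hasGradientAt_iff_hasFDerivAt, map_sub]
  exact (hasGradientAt_quadratic x).hasFDerivAt.sub hU.hasFDerivAt

theorem IsElementGradient.isPiecewiseSmooth (hG : T.IsElementGradient U G) :
    T.IsPiecewiseSmooth (quadratic - U) where
  continuousOn := continuous_quadratic.continuousOn.sub hG.continuousOn
  differentiableAt s hs x hx := (hG.hasGradientAt hs hx).differentiableAt
  bounded := by
    obtain ⟨R, hR⟩ := T.isCompact_closure.isBounded.exists_norm_le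
    obtain ⟨M, hM⟩ := (T.finite.image fun s => ‖G s‖).bddAbove
    refine ⟨2 * R + M, fun s hs x hx => ?_⟩
    rw [(hG.hasGradientAt hs hx).gradient]
    refine (norm_sub_le _ _).trans (add_le_add ?_ (hM ⟨s, hs, rfl⟩))
    rw [norm_smul]
    simpa using hR x (T.element_subset hs (interior_subset hx))

end Triangulation

/-! ### Second differences along a line -/

theorem sq_integral_le_integral_sq {X : Type*} [MeasurableSpace X] {μ : Measure X}
    [IsProbabilityMeasure μ] {φ : X → ℝ} (hφ : MemLp φ 2 μ) :
    (∫ x, φ x ∂μ) ^ 2 ≤ ∫ x, φ x ^ 2 ∂μ := by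
  have hvariance := ProbabilityTheory.variance_nonneg φ μ
  rw [ProbabilityTheory.variance_eq_sub hφ] at hvariance
  exact sub_nonneg.1 hvariance

theorem ofReal_sq_sub_le_lintegral_gradient {f : Plane → ℝ} {p d : Plane} {S : Set ℝ} {M : ℝ}
    (hS : S.Countable) (hcont : ContinuousOn (fun s : ℝ => f (p + s • d)) (Set.Icc 0 1))
    (hdiff : ∀ s ∈ Set.Icc (0 : ℝ) 1, s ∉ S → DifferentiableAt ℝ f (p + s • d))
    (hM : ∀ s ∈ Set.Icc (0 : ℝ) 1, s ∉ S → ‖gradient f (p + s • d)‖ ≤ M) :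
    ENNReal.ofReal ((f (p + d) - f p) ^ 2) ≤
      ∫⁻ s in Set.Icc (0 : ℝ) 1, ENNReal.ofReal (‖d‖ ^ 2 * ‖gradient f (p + s • d)‖ ^ 2) := by
  have hunit : IsProbabilityMeasure (volume.restrict (Set.Icc (0 : ℝ) 1)) := ⟨by simp⟩
  have hle (s : ℝ) : |inner ℝ (gradient f (p + s • d)) d| ≤ ‖gradient f (p + s • d)‖ * ‖d‖ :=
    abs_real_inner_le_norm _ _
  have hmemLp : MemLp (fun s : ℝ => inner ℝ (gradient f (p + s • d)) d) 2
      (volume.restrict (Set.Icc (0 : ℝ) 1)) := by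
    refine MemLp.of_bound (C := M * ‖d‖) (((measurable_gradient f).comp
      (by fun_prop)).inner measurable_const).aestronglyMeasurable ?_
    rw [ae_restrict_iff' measurableSet_Icc]
    filter_upwards [hS.ae_notMem volume] with s hsS hs
    exact (hle s).trans (mul_le_mul_of_nonneg_right (hM s hs hsS) (norm_nonneg d))
  have hderiv : ∀ s ∈ Set.Ioo (min (0 : ℝ) 1) (max 0 1) \ S,
      HasDerivAt (fun s : ℝ => f (p + s • d)) (inner ℝ (gradient f (p + s • d)) d) s := by
    rintro s ⟨hs, hsS⟩
    rw [min_eq_left zero_le_one, max_eq_right zero_le_one] at hs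
    have hline : HasDerivAt (fun s : ℝ => p + s • d) d s := by
      simpa only [one_smul, id_eq] using! ((hasDerivAt_id s).smul_const d).const_add p
    exact (hdiff s (Set.Ioo_subset_Icc_self hs) hsS).hasGradientAt.hasFDerivAt.comp_hasDerivAt
      s hline
  have hftc : f (p + d) - f p =
      ∫ s in Set.Icc (0 : ℝ) 1, inner ℝ (gradient f (p + s • d)) d := by
    have := integral_eq_of_hasDerivAt_off_countable _ _ hS
      (by rwa [Set.uIcc_of_le zero_le_one]) hderiv
      ((intervalIntegrable_iff_integrableOn_Icc_of_le zero_le_one).2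
        (hmemLp.integrable one_le_two))
    rwa [intervalIntegral.integral_of_le zero_le_one, ← integral_Icc_eq_integral_Ioc, one_smul,
      zero_smul, add_zero, eq_comm] at this
  rw [hftc]
  refine (ENNReal.ofReal_le_ofReal (sq_integral_le_integral_sq hmemLp)).trans ?_
  rw [ofReal_integral_eq_lintegral_ofReal hmemLp.integrable_sq (ae_of_all _ fun s => sq_nonneg _)]
  refine lintegral_mono fun s => ENNReal.ofReal_le_ofReal ?_
  rw [← sq_abs, ← mul_pow, mul_comm]
  exact pow_le_pow_left₀ (abs_nonneg _) (hle s) 2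

theorem linear_ne_zero_of_cross_ne_zero {ℓ : Plane →ₗ[ℝ] ℝ} (hℓ : ℓ ≠ 0) {g d : Plane}
    (hJ : cross g d ≠ 0) (hd : ℓ d = 0) : ℓ g ≠ 0 := by
  refine fun hg => hℓ (LinearMap.ext fun x => ?_)
  have hbasis : cross g d • x = cross x d • g + cross g x • d := by
    ext i
    fin_cases i <;> simp [cross_apply] <;> ring
  have := congrArg ℓ hbasis
  rw [map_add, map_smul, map_smul, map_smul, hd, hg] at this
  simpa [hJ] using this

theorem ae_finite_crossings {F : Set (Plane →ᵃ[ℝ] ℝ)} (hF : F.Finite)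
    (hlinear : ∀ A ∈ F, A.linear ≠ 0) (p : Plane) {g d : Plane} (hJ : cross g d ≠ 0) :
    ∀ᵐ t : ℝ, {s : ℝ | ∃ A ∈ F, A (p + t • g + s • d) = 0}.Finite := by
  have hexpand (A : Plane →ᵃ[ℝ] ℝ) (t s : ℝ) :
      A (p + t • g + s • d) = A p + t * A.linear g + s * A.linear d := by
    have h := A.linearMap_vsub (p + t • g + s • d) p
    simp only [vsub_eq_sub, add_assoc, add_sub_cancel_left, map_add, map_smul, smul_eq_mul] at h
    rw [add_assoc p]
    linarith
  have hnonparallel : ∀ᵐ t : ℝ, ∀ A ∈ F, t ≠ -A p / A.linear g := by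
    rw [ae_ball_iff hF.countable]
    exact fun A _ => (Set.countable_singleton (-A p / A.linear g)).ae_notMem volume
  filter_upwards [hnonparallel] with t ht
  refine (hF.image fun A => -(A p + t * A.linear g) / A.linear d).subset ?_
  rintro s ⟨A, hA, hzero⟩
  rw [hexpand] at hzero
  have hd : A.linear d ≠ 0 := fun hd => by
    have hg := linear_ne_zero_of_cross_ne_zero (hlinear A hA) hJ hd
    rw [hd] at hzero
    exact ht A hA (by field_simp; linarith)
  exact ⟨A, hA, by field_simp; linarith⟩

theorem add_smul_mem_of_convex {E : Type*} [AddCommGroup E] [Module ℝ E] {K : Set E}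
    (hK : Convex ℝ K) {p g : E} {a b x : ℝ} (ha : p + a • g ∈ K) (hb : p + b • g ∈ K)
    (hx : x ∈ Set.Icc a b) : p + x • g ∈ K := by
  have hline (c : ℝ) : AffineMap.lineMap p (p + g) c = p + c • g := by
    rw [AffineMap.lineMap_apply_module']
    module
  have hord := (hK.affine_preimage (AffineMap.lineMap p (p + g) : ℝ →ᵃ[ℝ] E)).ordConnected
  simpa only [Set.mem_preimage, hline] using hord.out (x := a) (y := b)
    (by simpa only [Set.mem_preimage, hline] using ha)
    (by simpa only [Set.mem_preimage, hline] using hb) hx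

theorem lintegral_sq_add_le {X : Type*} [MeasurableSpace X] {μ : Measure X} {u v : X → ℝ}
    {a : ℝ} (hu : AEMeasurable u μ)
    (hua : ∫⁻ x, ENNReal.ofReal (u x ^ 2) ∂μ ≤ ENNReal.ofReal a)
    (hva : ∫⁻ x, ENNReal.ofReal (v x ^ 2) ∂μ ≤ ENNReal.ofReal a) :
    ∫⁻ x, ENNReal.ofReal ((u x + v x) ^ 2) ∂μ ≤ ENNReal.ofReal (4 * a) := by
  calc ∫⁻ x, ENNReal.ofReal ((u x + v x) ^ 2) ∂μ
      ≤ ∫⁻ x, 2 * (ENNReal.ofReal (u x ^ 2) + ENNReal.ofReal (v x ^ 2)) ∂μ := by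
        refine lintegral_mono fun x => ?_
        rw [← ENNReal.ofReal_add (sq_nonneg _) (sq_nonneg _), ← ENNReal.ofReal_ofNat,
          ← ENNReal.ofReal_mul zero_le_two]
        exact ENNReal.ofReal_le_ofReal add_sq_le
    _ = 2 * (∫⁻ x, ENNReal.ofReal (u x ^ 2) ∂μ + ∫⁻ x, ENNReal.ofReal (v x ^ 2) ∂μ) := by
        rw [lintegral_const_mul' _ _ ENNReal.ofNat_ne_top, lintegral_add_left' (by fun_prop)]
    _ ≤ 2 * (ENNReal.ofReal a + ENNReal.ofReal a) := by gcongr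
    _ = ENNReal.ofReal (4 * a) := by
        rw [← two_mul, ← mul_assoc, ENNReal.ofReal_mul zero_le_four, ENNReal.ofReal_ofNat]
        norm_num

namespace Triangulation.IsPiecewiseSmooth

variable {Ω : Set Plane} {T : Triangulation Ω} {f : Plane → ℝ}

theorem aemeasurable_comp (hf : T.IsPiecewiseSmooth f) {γ : ℝ → Plane} (hγ : Continuous γ) {a b : ℝ}
    (hmem : ∀ t ∈ Set.Icc a b, γ t ∈ closure Ω) :
    AEMeasurable (fun t => f (γ t)) (volume.restrict (Set.Icc a b)) :=
  (hf.continuousOn.comp hγ.continuousOn hmem).aemeasurable measurableSet_Icc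

theorem lintegral_sq_sub_le (hf : T.IsPiecewiseSmooth f) {p g d : Plane} (hJ : cross g d ≠ 0)
    {I : Set ℝ} (hI : MeasurableSet I)
    (hmem : ∀ t ∈ I, ∀ s ∈ Set.Icc (0 : ℝ) 1, p + t • g + s • d ∈ closure Ω) :
    ∫⁻ t in I, ENNReal.ofReal ((f (p + t • g + d) - f (p + t • g)) ^ 2) ≤
      ENNReal.ofReal (‖d‖ ^ 2 * |(cross g d)⁻¹| * h1Seminorm (closure Ω) f ^ 2) := by
  obtain ⟨F, hF, hlinear, hinterior⟩ := T.exists_finite_edgeLines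
  obtain ⟨M, hM⟩ := hf.bounded
  have htrace : ∀ᵐ t : ℝ, t ∈ I →
      ENNReal.ofReal ((f (p + t • g + d) - f (p + t • g)) ^ 2) ≤
      ∫⁻ s in Set.Icc (0 : ℝ) 1,
        ENNReal.ofReal (‖d‖ ^ 2 * ‖gradient f (p + t • g + s • d)‖ ^ 2) := by
    filter_upwards [ae_finite_crossings hF hlinear p hJ] with t hfinite ht
    have hgood (s : ℝ) (hs : s ∈ Set.Icc (0 : ℝ) 1)
        (hsF : s ∉ {s : ℝ | ∃ A ∈ F, A (p + t • g + s • d) = 0}) :=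
      hinterior _ (hmem t ht s hs) fun A hA hzero => hsF ⟨A, hA, hzero⟩
    refine ofReal_sq_sub_le_lintegral_gradient hfinite.countable
      (hf.continuousOn.comp (by fun_prop) (hmem t ht)) (M := M)
      (fun s hs hsF => ?_) (fun s hs hsF => ?_)
    · obtain ⟨e, he, hpe⟩ := hgood s hs hsF
      exact hf.differentiableAt e he _ hpe
    · obtain ⟨e, he, hpe⟩ := hgood s hs hsF
      exact hM e he _ hpe
  have hmeas := ((measurable_gradient f).norm.pow_const 2).ennreal_ofReal
  calc ∫⁻ t in I, ENNReal.ofReal ((f (p + t • g + d) - f (p + t • g)) ^ 2)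
      ≤ ∫⁻ t in I, ∫⁻ s in Set.Icc (0 : ℝ) 1,
        ENNReal.ofReal (‖d‖ ^ 2 * ‖gradient f (p + t • g + s • d)‖ ^ 2) :=
        setLIntegral_mono_ae' hI htrace
    _ ≤ ENNReal.ofReal |(cross g d)⁻¹| *
        ∫⁻ x in closure Ω, ENNReal.ofReal (‖d‖ ^ 2 * ‖gradient f x‖ ^ 2) :=
        lintegral_parallelogram_le hJ isClosed_closure.measurableSet hI measurableSet_Icc hmem
          (((measurable_gradient f).norm.pow_const 2).const_mul _).ennreal_ofReal
    _ = ENNReal.ofReal (‖d‖ ^ 2 * |(cross g d)⁻¹| * h1Seminorm (closure Ω) f ^ 2) := by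
        simp_rw [ENNReal.ofReal_mul (sq_nonneg ‖d‖)]
        rw [lintegral_const_mul _ hmeas, ← hf.h1Seminorm_sq,
          ENNReal.ofReal_mul (by positivity), ENNReal.ofReal_mul (sq_nonneg ‖d‖)]
        ring

theorem lintegral_sq_sub_le_of_convex (hf : T.IsPiecewiseSmooth f) {K : Set Plane}
    (hK : Convex ℝ K) (hKΩ : K ⊆ closure Ω) {p g d : Plane} (hJ : cross g d ≠ 0) {a : ℝ}
    (hmem : ∀ t ∈ Set.Icc 0 a, p + t • g ∈ K) (hmemd : ∀ t ∈ Set.Icc 0 a, p + t • g + d ∈ K) :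
    ∫⁻ t in Set.Icc 0 a, ENNReal.ofReal ((f (p + t • g + d) - f (p + t • g)) ^ 2) ≤
      ENNReal.ofReal (Metric.diam (closure Ω) ^ 2 * |(cross g d)⁻¹| *
        h1Seminorm (closure Ω) f ^ 2) := by
  rcases lt_or_ge a 0 with ha | ha
  · simp [Set.Icc_eq_empty ha.not_ge]
  have hd : ‖d‖ ≤ Metric.diam (closure Ω) := by
    simpa only [dist_eq_norm, add_sub_cancel_left] using Metric.dist_le_diam_of_mem
      T.isCompact_closure.isBounded (hKΩ (hmemd 0 ⟨le_rfl, ha⟩)) (hKΩ (hmem 0 ⟨le_rfl, ha⟩))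
  refine (hf.lintegral_sq_sub_le hJ measurableSet_Icc fun t ht s hs => hKΩ ?_).trans
    (ENNReal.ofReal_le_ofReal (by gcongr))
  exact add_smul_mem_of_convex hK (by simpa using hmem t ht) (by simpa using hmemd t ht) hs

/- The two points of the line are joined through the apex `p + t • g + d`. -/
theorem lintegral_sq_difference_le (hf : T.IsPiecewiseSmooth f) {K : Set Plane}
    (hK : Convex ℝ K) (hKΩ : K ⊆ closure Ω) {p g d : Plane} (hJ : cross g d ≠ 0) {a δ : ℝ}
    (hmem : ∀ t ∈ Set.Icc 0 a, p + t • g ∈ K) (hmemδ : ∀ t ∈ Set.Icc 0 a, p + (t + δ) • g ∈ K)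
    (hapex : ∀ t ∈ Set.Icc 0 a, p + t • g + d ∈ K) :
    ∫⁻ t in Set.Icc 0 a, ENNReal.ofReal ((f (p + (t + δ) • g) - f (p + t • g)) ^ 2) ≤
      ENNReal.ofReal (4 * (Metric.diam (closure Ω) ^ 2 * |(cross g d)⁻¹| *
        h1Seminorm (closure Ω) f ^ 2)) := by
  have hcross : cross g (d - δ • g) = cross g d := by simp
  have hshift (t : ℝ) : p + δ • g + t • g = p + (t + δ) • g := by module
  have hback (t : ℝ) : p + (t + δ) • g + (d - δ • g) = p + t • g + d := by module
  have hright := hf.lintegral_sq_sub_le_of_convex hK hKΩ (p := p + δ • g) (d := d - δ • g)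
    (a := a) (by rwa [hcross]) (by simpa only [hshift] using hmemδ)
    (by simpa only [hshift, hback] using hapex)
  simp only [hshift, hback, hcross] at hright
  have hmeasurable : AEMeasurable (fun t => f (p + t • g + d) - f (p + t • g))
      (volume.restrict (Set.Icc 0 a)) :=
    (hf.aemeasurable_comp (by fun_prop) fun t ht => hKΩ (hapex t ht)).sub
      (hf.aemeasurable_comp (by fun_prop) fun t ht => hKΩ (hmem t ht))
  simpa only [sub_add_sub_cancel'] using lintegral_sq_add_le hmeasurable
    (hf.lintegral_sq_sub_le_of_convex hK hKΩ hJ hmem hapex)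
    (v := fun t => f (p + (t + δ) • g) - f (p + t • g + d))
    (by simpa only [sub_sq_comm] using hright)

theorem lintegral_sq_shifted_difference_le (hf : T.IsPiecewiseSmooth f) {K : Set Plane}
    (hK : Convex ℝ K) (hKΩ : K ⊆ closure Ω) {p g z : Plane} {δ σ : ℝ} (hp : p ∈ K)
    (hq : p + (3 * δ) • g ∈ K) (hz : z ∈ K) (hJ : cross g (z - p) ≠ 0) (hσ : σ ∈ Set.Icc 0 δ) :
    ∫⁻ t in Set.Icc 0 δ, ENNReal.ofReal
        ((f (p + (t + σ + δ) • g) - f (p + (t + σ) • g)) ^ 2) ≤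
      ENNReal.ofReal (12 * Metric.diam (closure Ω) ^ 2 * |(cross g (z - p))⁻¹| *
        h1Seminorm (closure Ω) f ^ 2) := by
  have hcross : cross g ((1 / 3 : ℝ) • (z - p)) = cross g (z - p) / 3 := by
    rw [map_smul, smul_eq_mul, one_div_mul_eq_div]
  have hshift (t : ℝ) : p + σ • g + t • g = p + (t + σ) • g := by module
  have hline : ∀ t ∈ Set.Icc 0 (3 * δ), p + t • g ∈ K := fun t ht =>
    add_smul_mem_of_convex hK (by simpa using hp) hq ht
  have hapex : ∀ t ∈ Set.Icc 0 (2 * δ), p + t • g + (1 / 3 : ℝ) • (z - p) ∈ K := by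
    intro t ht
    convert hK (hline (3 / 2 * t) ⟨by linarith [ht.1], by linarith [ht.2]⟩) hz
      (a := 2 / 3) (b := 1 / 3) (by norm_num) (by norm_num) (by norm_num) using 1
    module
  obtain ⟨hσ0, hσδ⟩ := hσ
  have hdiff := hf.lintegral_sq_difference_le hK hKΩ (p := p + σ • g) (a := δ) (δ := δ)
    (hcross ▸ div_ne_zero hJ three_ne_zero)
    (fun t ht => hshift t ▸ hline _ ⟨by linarith [ht.1], by linarith [ht.1, ht.2]⟩)
    (fun t ht => hshift _ ▸ hline _ ⟨by linarith [ht.1], by linarith [ht.1, ht.2]⟩)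
    (fun t ht => hshift t ▸ hapex _ ⟨by linarith [ht.1], by linarith [ht.2]⟩)
  rw [hcross, inv_div, div_eq_mul_inv, abs_mul, abs_of_pos three_pos] at hdiff
  simp only [hshift, add_right_comm _ δ σ] at hdiff
  exact hdiff.trans_eq (congrArg _ (by ring))

theorem lintegral_sq_second_difference_le (hf : T.IsPiecewiseSmooth f) {K : Set Plane}
    (hK : Convex ℝ K) (hKΩ : K ⊆ closure Ω) {p g z : Plane} {δ : ℝ} (hp : p ∈ K)
    (hq : p + (3 * δ) • g ∈ K) (hz : z ∈ K) (hJ : cross g (z - p) ≠ 0) :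
    ∫⁻ t in Set.Icc 0 δ, ENNReal.ofReal
        ((f (p + t • g) - 2 * f (p + (t + δ) • g) + f (p + (t + 2 * δ) • g)) ^ 2) ≤
      ENNReal.ofReal (48 * Metric.diam (closure Ω) ^ 2 * |(cross g (z - p))⁻¹| *
        h1Seminorm (closure Ω) f ^ 2) := by
  obtain hδ | hδ := lt_or_ge δ 0
  · simp [Set.Icc_eq_empty hδ.not_ge]
  have hleft := hf.lintegral_sq_shifted_difference_le hK hKΩ hp hq hz hJ ⟨le_rfl, hδ⟩
  have hright := hf.lintegral_sq_shifted_difference_le hK hKΩ hp hq hz hJ ⟨hδ, le_rfl⟩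
  simp only [add_zero] at hleft
  have hmem : ∀ t ∈ Set.Icc 0 (3 * δ), p + t • g ∈ closure Ω := fun t ht =>
    hKΩ (add_smul_mem_of_convex hK (by simpa using hp) hq ht)
  have hmeasurable : AEMeasurable (fun t => f (p + t • g) - f (p + (t + δ) • g))
      (volume.restrict (Set.Icc 0 δ)) :=
    (hf.aemeasurable_comp (by fun_prop) fun t ht =>
      hmem t ⟨ht.1, by linarith [ht.2]⟩).sub
      (hf.aemeasurable_comp (by fun_prop) fun t ht =>
        hmem _ ⟨by linarith [ht.1], by linarith [ht.2]⟩)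
  have hsum := lintegral_sq_add_le hmeasurable (by simpa only [sub_sq_comm] using hleft) hright
  refine (lintegral_congr fun t => ?_).trans_le (hsum.trans_eq (congrArg _ (by ring)))
  rw [add_assoc t δ δ, ← two_mul]
  ring_nf

theorem pow_five_le (hf : T.IsPiecewiseSmooth f) {K : Set Plane} (hK : Convex ℝ K)
    (hKΩ : K ⊆ closure Ω) {p g z : Plane} {δ : ℝ} (hp : p ∈ K)
    (hq : p + (3 * δ) • g ∈ K) (hz : z ∈ K) (hJ : cross g (z - p) ≠ 0)
    (hsecond : ∀ t ∈ Set.Icc 0 δ, δ ^ 2 ≤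
      |f (p + t • g) - 2 * f (p + (t + δ) • g) + f (p + (t + 2 * δ) • g)|) :
    δ ^ 5 ≤ 48 * Metric.diam (closure Ω) ^ 2 * |(cross g (z - p))⁻¹| *
      h1Seminorm (closure Ω) f ^ 2 := by
  rw [← ENNReal.ofReal_le_ofReal_iff (by positivity)]
  refine le_trans ?_ (hf.lintegral_sq_second_difference_le hK hKΩ hp hq hz hJ)
  calc ENNReal.ofReal (δ ^ 5) = ∫⁻ t in Set.Icc 0 δ, ENNReal.ofReal (δ ^ 4) := by
        rw [setLIntegral_const, Real.volume_Icc, sub_zero, ← ENNReal.ofReal_mul (by positivity),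
          ← pow_succ]
    _ ≤ _ := by
        refine setLIntegral_mono' measurableSet_Icc fun t ht => ENNReal.ofReal_le_ofReal ?_
        rw [← sq_abs (_ + _), show δ ^ 4 = (δ ^ 2) ^ 2 by ring]
        exact pow_le_pow_left₀ (sq_nonneg δ) (hsecond t ht) 2

end Triangulation.IsPiecewiseSmooth

/-! ### The slope along a band -/

theorem sum_succ_sub_castSucc {n : ℕ} (t : Fin (n + 1) → ℝ) :
    ∑ i : Fin n, (t i.succ - t i.castSucc) = t (Fin.last n) - t 0 := by
  rw [Finset.sum_sub_distrib]
  linarith [Fin.sum_univ_succ t, Fin.sum_univ_castSucc t]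

theorem abs_sub_zero_le_sum {n : ℕ} (a : Fin (n + 1) → ℝ) (i : Fin (n + 1)) :
    |a i - a 0| ≤ ∑ j : Fin n, |a j.succ - a j.castSucc| := by
  induction n with
  | zero => simp [Fin.fin_one_eq_zero i]
  | succ n ih =>
    have hinit (j : Fin (n + 1)) := ih (fun k => a k.castSucc) j
    rw [Fin.sum_univ_castSucc]
    simp only [Fin.succ_castSucc, Fin.castSucc_zero] at hinit ⊢
    cases i using Fin.lastCases with
    | last =>
      rw [Fin.succ_last]
      linarith [hinit (Fin.last n),
        abs_sub_le (a (Fin.last (n + 1))) (a (Fin.last n).castSucc) (a 0)]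
    | cast j => exact (hinit j).trans (le_add_of_nonneg_right (abs_nonneg _))

theorem exists_mem_Ico {n : ℕ} (t : Fin (n + 1) → ℝ) {x : ℝ}
    (hx : x ∈ Set.Ico (t 0) (t (Fin.last n))) :
    ∃ i : Fin n, x ∈ Set.Ico (t i.castSucc) (t i.succ) := by
  induction n with
  | zero => exact absurd (hx.1.trans_lt hx.2) (lt_irrefl _)
  | succ n ih =>
    by_cases h : t (Fin.last n).castSucc ≤ x
    · exact ⟨Fin.last n, h, by simpa using hx.2⟩
    · obtain ⟨i, hi⟩ := ih (fun i => t i.castSucc) ⟨hx.1, not_le.1 h⟩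
      exact ⟨i.castSucc, hi⟩

namespace Band

variable {Ω : Set Plane} {T : Triangulation Ω} {N : ℕ} {B : Band T N}

/-- `g` is the unit direction of the line carrying the points `P i` of the band, and `t i` is the
arclength parameter of `P i` on that line, counted from `P 0`. -/
structure IsArclength (B : Band T N) (g : Plane) (t : Fin (N + 2) → ℝ) : Prop where
  norm_dir : ‖g‖ = 1
  strictMono : StrictMono t
  zero : t 0 = 0
  P_eq : ∀ i, B.P i = B.P 0 + t i • g

/-- The total variation along the band of the tangential derivative of the function whose gradient
on each element `s` is `G s`. -/
noncomputable def slopeVariation (B : Band T N) (G : Set Plane → Plane) (g : Plane) : ℝ :=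
  ∑ i : Fin N, |inner ℝ (G (B.K i.succ)) g - inner ℝ (G (B.K i.castSucc)) g|

theorem exists_isArclength (B : Band T N) : ∃ g t, B.IsArclength g t := by
  obtain ⟨g, hg, t, ht, hP⟩ := B.straight
  have hg0 : g ≠ 0 := by
    rintro rfl
    simp at hg
  exact ⟨g, t, hg, ht, by simpa [hg0] using hP 0, hP⟩

variable {U : Plane → ℝ} {G : Set Plane → Plane} {g : Plane} {t : Fin (N + 2) → ℝ}

theorem slopeVariation_nonneg (B : Band T N) (G : Set Plane → Plane) (g : Plane) :
    0 ≤ B.slopeVariation G g :=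
  Finset.sum_nonneg fun _ _ => abs_nonneg _

namespace IsArclength

theorem sub_eq (h : B.IsArclength g t) (i j : Fin (N + 2)) : B.P j - B.P i = (t j - t i) • g := by
  rw [h.P_eq j, h.P_eq i]
  module

theorem last (h : B.IsArclength g t) : t (Fin.last _) = B.length := by
  rw [← sub_zero (t _), ← h.zero, ← sum_succ_sub_castSucc, length]
  refine Finset.sum_congr rfl fun i _ => ?_
  rw [dist_comm, dist_eq_norm, h.sub_eq, norm_smul, h.norm_dir, mul_one, Real.norm_of_nonneg]
  exact sub_nonneg.2 (h.strictMono Fin.castSucc_lt_succ).le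

theorem length_pos (h : B.IsArclength g t) : 0 < B.length := by
  rw [← h.last, ← h.zero]
  exact h.strictMono (Fin.last_pos)

theorem mem_convexHull_K (h : B.IsArclength g t) {i : Fin (N + 1)} {x : ℝ}
    (hx : x ∈ Set.Icc (t i.castSucc) (t i.succ)) : B.P 0 + x • g ∈ convexHull ℝ (B.K i) := by
  refine add_smul_mem_of_convex (convex_convexHull ℝ _) ?_ ?_ hx <;>
    · rw [← h.P_eq]
      exact subset_convexHull ℝ _ (by simp [K])

theorem mem_closure (h : B.IsArclength g t) {x : ℝ} (hx : x ∈ Set.Icc 0 B.length) :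
    B.P 0 + x • g ∈ closure Ω := by
  suffices ∃ i : Fin (N + 1), x ∈ Set.Icc (t i.castSucc) (t i.succ) by
    obtain ⟨i, hi⟩ := this
    exact T.element_subset (B.mem_K i) (h.mem_convexHull_K hi)
  rw [← h.zero, ← h.last] at hx
  rcases hx.2.eq_or_lt with rfl | hlt
  · exact ⟨Fin.last N, h.strictMono.monotone (Fin.le_last _), by rw [Fin.succ_last]⟩
  · exact (exists_mem_Ico t ⟨hx.1, hlt⟩).imp fun i hi => Set.Ico_subset_Icc_self hi

theorem hasDerivWithinAt (h : B.IsArclength g t) (hG : T.IsElementGradient U G)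
    {i : Fin (N + 1)} {x : ℝ} (hx : x ∈ Set.Ico (t i.castSucc) (t i.succ)) :
    HasDerivWithinAt (fun y => U (B.P 0 + y • g)) (inner ℝ (G (B.K i)) g) (Set.Ici x) x := by
  have haffine : HasDerivAt (fun y => U (B.P 0 + x • g) + inner ℝ (G (B.K i)) g * (y - x))
      (inner ℝ (G (B.K i)) g) x := by
    simpa using (((hasDerivAt_id x).sub_const x).const_mul _).const_add (U (B.P 0 + x • g))
  refine haffine.hasDerivWithinAt.congr_of_eventuallyEq ?_ (by simp)
  filter_upwards [Ico_mem_nhdsGE hx.2] with y hy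
  have hinc := hG.sub_eq _ (B.mem_K i) _ (h.mem_convexHull_K (Set.Ico_subset_Icc_self hx)) _
    (h.mem_convexHull_K ⟨hx.1.trans hy.1, hy.2.le⟩)
  rw [add_sub_add_left_eq_sub, ← sub_smul, real_inner_smul_right] at hinc
  rw [← sub_eq_iff_eq_add', hinc, mul_comm]
  rfl

theorem abs_sub_sub_le (h : B.IsArclength g t) (hG : T.IsElementGradient U G) {x y : ℝ}
    (hx : 0 ≤ x) (hxy : x ≤ y) (hy : y ≤ B.length) :
    |U (B.P 0 + y • g) - U (B.P 0 + x • g) - inner ℝ (G (B.K 0)) g * (y - x)| ≤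
      B.slopeVariation G g * (y - x) := by
  have hmem (w) (hw : w ∈ Set.Ico x y) :
      ∃ i : Fin (N + 1), w ∈ Set.Ico (t i.castSucc) (t i.succ) :=
    exists_mem_Ico t (by rw [h.zero, h.last]; exact ⟨hx.trans hw.1, hw.2.trans_le hy⟩)
  choose! i hi using hmem
  have hcont : ContinuousOn (fun w : ℝ => U (B.P 0 + w • g) - inner ℝ (G (B.K 0)) g * w)
      (Set.Icc x y) :=
    (hG.continuousOn.comp (by fun_prop) fun w hw =>
      h.mem_closure ⟨hx.trans hw.1, hw.2.trans hy⟩).sub (by fun_prop)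
  have hslope := norm_image_sub_le_of_norm_deriv_right_le_segment
    (f' := fun w => inner ℝ (G (B.K (i w))) g - inner ℝ (G (B.K 0)) g * 1)
    (C := B.slopeVariation G g) hcont
    (fun w hw => (h.hasDerivWithinAt hG (hi w hw)).sub
      ((hasDerivAt_id w).const_mul _).hasDerivWithinAt)
    (fun w _ => by
      simpa [slopeVariation] using abs_sub_zero_le_sum (fun j => inner ℝ (G (B.K j)) g) (i w))
    y ⟨hxy, le_rfl⟩
  rw [Real.norm_eq_abs] at hslope
  convert! hslope using 2
  ring

theorem quadratic_eq (h : B.IsArclength g t) (s : ℝ) :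
    quadratic (B.P 0 + s • g) = ‖B.P 0‖ ^ 2 + 2 * s * inner ℝ (B.P 0) g + s ^ 2 := by
  rw [FEM.quadratic_eq, norm_add_sq_real, norm_smul, h.norm_dir, real_inner_smul_right, mul_one,
    Real.norm_eq_abs, sq_abs]
  ring

theorem sq_le_abs_second_difference (h : B.IsArclength g t) (hG : T.IsElementGradient U G)
    {x δ : ℝ} (hx : 0 ≤ x) (hδ : 0 ≤ δ) (hy : x + 2 * δ ≤ B.length)
    (hS : B.slopeVariation G g ≤ δ / 2) :
    δ ^ 2 ≤ |(quadratic - U) (B.P 0 + x • g) - 2 * (quadratic - U) (B.P 0 + (x + δ) • g) +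
      (quadratic - U) (B.P 0 + (x + 2 * δ) • g)| := by
  have hfirst := abs_le.1 (h.abs_sub_sub_le hG hx (y := x + δ) (by linarith) (by linarith))
  have hsecond := abs_le.1 (h.abs_sub_sub_le hG (x := x + δ) (y := x + 2 * δ) (by linarith)
    (by linarith) hy)
  rw [show x + δ - x = δ by ring] at hfirst
  rw [show x + 2 * δ - (x + δ) = δ by ring] at hsecond
  have hvar : B.slopeVariation G g * δ ≤ δ / 2 * δ := mul_le_mul_of_nonneg_right hS hδ
  refine le_trans ?_ (le_abs_self _)
  simp only [Pi.sub_apply, h.quadratic_eq]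
  linarith [hfirst.1, hfirst.2, hsecond.1, hsecond.2]

end IsArclength

end Band

theorem abs_cross_le_of_norm_eq_one {g : Plane} (hg : ‖g‖ = 1) (v w : Plane) :
    |cross v w| ≤ ‖v‖ * |cross g w| + |cross g v| * ‖w‖ := by
  have hframe : cross v w = inner ℝ g v * cross g w - cross g v * inner ℝ g w := by
    have hg2 := norm_sq_eq g
    rw [hg] at hg2
    simp only [inner_eq, cross_apply]
    linear_combination (v 0 * w 1 - v 1 * w 0) * hg2
  have hinner (u : Plane) : |inner ℝ g u| ≤ ‖u‖ := by
    simpa [hg] using abs_real_inner_le_norm g u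
  calc |cross v w| ≤ |inner ℝ g v * cross g w| + |cross g v * inner ℝ g w| :=
        hframe ▸ abs_sub _ _
    _ ≤ _ := by
        rw [abs_mul, abs_mul]
        gcongr <;> exact hinner _

theorem exists_vertex_far {a b c : Plane} (h : cross (b - a) (c - a) ≠ 0) :
    ∃ ρ > 0, ∀ g p : Plane, ‖g‖ = 1 → ∃ z ∈ ({a, b, c} : Set Plane), ρ ≤ |cross g (z - p)| := by
  have hsize : 0 < ‖b - a‖ + ‖c - a‖ := by
    refine add_pos_of_pos_of_nonneg (norm_pos_iff.2 fun hba => h ?_) (norm_nonneg _)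
    rw [hba, map_zero, LinearMap.zero_apply]
  refine ⟨|cross (b - a) (c - a)| / (4 * (‖b - a‖ + ‖c - a‖)),
    div_pos (abs_pos.2 h) (by positivity), fun g p hg => ?_⟩
  set ρ := |cross (b - a) (c - a)| / (4 * (‖b - a‖ + ‖c - a‖))
  have hρ : 0 < ρ := div_pos (abs_pos.2 h) (by positivity)
  by_contra! hclose
  have hedge {z : Plane} (hz : z ∈ ({a, b, c} : Set Plane)) : |cross g (z - a)| ≤ 2 * ρ := by
    rw [show z - a = z - p - (a - p) by abel, map_sub]
    linarith [abs_sub (cross g (z - p)) (cross g (a - p)), hclose z hz, hclose a (by simp)]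
  have hlarge : |cross (b - a) (c - a)| ≤ ‖b - a‖ * (2 * ρ) + 2 * ρ * ‖c - a‖ := by
    refine (abs_cross_le_of_norm_eq_one hg _ _).trans ?_
    gcongr <;> exact hedge (by simp)
  have hρ_def : |cross (b - a) (c - a)| = 4 * ρ * (‖b - a‖ + ‖c - a‖) := by
    simp only [ρ]
    field_simp
  nlinarith

namespace Triangulation

variable {Ω : Set Plane}

theorem exists_uniform_far (T : Triangulation Ω) : ∃ ρ > 0, ∀ s ∈ T.elements, ∀ g p : Plane,
    ‖g‖ = 1 → ∃ z ∈ s, ρ ≤ |cross g (z - p)| := by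
  have hvertex (s) (hs : s ∈ T.elements) :
      ∃ ρ > 0, ∀ g p : Plane, ‖g‖ = 1 → ∃ z ∈ s, ρ ≤ |cross g (z - p)| := by
    have hpos := T.area_pos hs
    obtain ⟨a, b, c, -, rfl⟩ := T.nondegenerate s hs
    refine exists_vertex_far fun h0 => hpos.ne' ?_
    rw [area_eq, h0, abs_zero, zero_div]
  choose! ρ hρ hfar using hvertex
  obtain ⟨ρ₀, hρ₀, hle⟩ : ∃ ρ₀ > 0, ∀ s ∈ T.elements, ρ₀ ≤ ρ s := by
    rcases T.elements.eq_empty_or_nonempty with hempty | hne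
    · exact ⟨1, one_pos, by simp [hempty]⟩
    · obtain ⟨s₀, hs₀, hmin⟩ := Set.exists_min_image T.elements ρ T.finite hne
      exact ⟨ρ s₀, hρ s₀ hs₀, hmin⟩
  refine ⟨ρ₀, hρ₀, fun s hs g p hg => ?_⟩
  obtain ⟨z, hz, hzρ⟩ := hfar s hs g p hg
  exact ⟨z, hz, (hle s hs).trans hzρ⟩

theorem exists_long_subsegment (T : Triangulation Ω) {p g : Plane} {L : ℝ} (hL : 0 ≤ L)
    (hmem : ∀ x ∈ Set.Icc 0 L, p + x • g ∈ closure Ω) :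
    ∃ s ∈ T.elements, ∃ x, 0 ≤ x ∧ x + L / (T.elements.ncard + 1) ≤ L ∧
      p + x • g ∈ convexHull ℝ s ∧ p + (x + L / (T.elements.ncard + 1)) • g ∈ convexHull ℝ s := by
  set M := T.elements.ncard
  set τ := L / (M + 1)
  have hτ : 0 ≤ τ := by positivity
  have hτM : (M + 1) * τ = L := by simp only [τ]; field_simp
  have hpoint (k) (hk : k ∈ Finset.range (M + 1)) :
      ∃ s ∈ T.elements, p + ((k : ℝ) * τ) • g ∈ convexHull ℝ s := by
    refine T.exists_mem_of_mem_closure (hmem _ ⟨by positivity, ?_⟩)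
    rw [← hτM]
    gcongr
    exact_mod_cast (Finset.mem_range.1 hk).le
  choose! e he hpe using hpoint
  obtain ⟨k, hk, l, hl, hne, hkl⟩ := Finset.exists_ne_map_eq_of_card_lt_of_maps_to
    (s := Finset.range (M + 1)) (t := T.finite.toFinset) (f := e)
    (by rw [← Set.ncard_eq_toFinset_card _ T.finite, Finset.card_range]; exact Nat.lt_succ_self M)
    (fun k hk => by simpa using he k hk)
  wlog hlt : k < l generalizing k l
  · exact this l hl k hk hne.symm hkl.symm (lt_of_le_of_ne (not_lt.1 hlt) hne.symm)
  have hstep : (k : ℝ) * τ + τ ≤ l * τ := by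
    rw [← add_one_mul]
    gcongr
    exact_mod_cast hlt
  refine ⟨e k, he k hk, k * τ, by positivity, ?_, hpe k hk, ?_⟩
  · rw [← add_one_mul, ← hτM]
    gcongr
    exact_mod_cast Finset.mem_range_succ_iff.1 hk
  · exact add_smul_mem_of_convex (convex_convexHull ℝ _) (hpe k hk) (hkl ▸ hpe l hl)
      ⟨by linarith, hstep⟩

theorem exists_fat_subsegment (T : Triangulation Ω) : ∃ ε > 0, ∃ ρ > 0, ∀ {p g : Plane} {L : ℝ},
    ‖g‖ = 1 → 0 ≤ L → (∀ x ∈ Set.Icc 0 L, p + x • g ∈ closure Ω) →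
    ∃ s ∈ T.elements, ∃ x, 0 ≤ x ∧ x + 3 * (ε * L) ≤ L ∧ p + x • g ∈ convexHull ℝ s ∧
      p + (x + 3 * (ε * L)) • g ∈ convexHull ℝ s ∧ ∃ z ∈ s, ρ ≤ |cross g (z - (p + x • g))| := by
  obtain ⟨ρ, hρ, hfar⟩ := T.exists_uniform_far
  refine ⟨1 / (3 * (T.elements.ncard + 1)), by positivity, ρ, hρ, fun {p g L} hg hL hmem => ?_⟩
  obtain ⟨s, hs, x, hx, hxL, hxs, hys⟩ := T.exists_long_subsegment hL hmem
  rw [show 3 * (1 / (3 * ((T.elements.ncard : ℝ) + 1)) * L) = L / (T.elements.ncard + 1) by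
    field_simp]
  exact ⟨s, hs, x, hx, hxL, hxs, hys, hfar s hs g _ hg⟩

end Triangulation

theorem exists_length_lt_mul_slopeVariation (Ω : Set Plane) :
    ∃ κ > 0, ∀ (T : Triangulation Ω) {U : Plane → ℝ} {G : Set Plane → Plane},
      T.IsElementGradient U G → ∀ {N : ℕ} (B : Band T N) {g : Plane} {t : Fin (N + 2) → ℝ},
      B.IsArclength g t → κ * h1Seminorm (closure Ω) (quadratic - U) ^ 2 < B.length ^ 5 →
      B.length < κ * B.slopeVariation G g := by
  rcases isEmpty_or_nonempty (Triangulation Ω) with hempty | ⟨⟨T₀⟩⟩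
  · exact ⟨1, one_pos, fun T => hempty.elim T⟩
  obtain ⟨ε, hε, ρ, hρ, hfat⟩ := T₀.exists_fat_subsegment
  set D := 48 * Metric.diam (closure Ω) ^ 2 * ρ⁻¹
  have : 0 ≤ D := by positivity
  refine ⟨D / ε ^ 5 + 2 / ε, by positivity, fun T U G hG N B g t h hlong => ?_⟩
  have hL := h.length_pos
  obtain ⟨s, hs, x, hx, hxL, hxs, hys, z, hz, hzρ⟩ := hfat h.norm_dir hL.le fun x => h.mem_closure
  set δ := ε * B.length
  have hδ : 0 ≤ δ := by positivity
  have hbig : D * h1Seminorm (closure Ω) (quadratic - U) ^ 2 < δ ^ 5 := calc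
    D * h1Seminorm (closure Ω) (quadratic - U) ^ 2
      = ε ^ 5 * (D / ε ^ 5 * h1Seminorm (closure Ω) (quadratic - U) ^ 2) := by field_simp
    _ ≤ ε ^ 5 * ((D / ε ^ 5 + 2 / ε) * h1Seminorm (closure Ω) (quadratic - U) ^ 2) := by
        gcongr
        exact le_add_of_nonneg_right (by positivity)
    _ < ε ^ 5 * B.length ^ 5 := by gcongr
    _ = δ ^ 5 := (mul_pow _ _ _).symm
  have hvar : δ / 2 < B.slopeVariation G g := by
    by_contra! hS
    refine hbig.not_ge ((hG.isPiecewiseSmooth.pow_five_le (convex_convexHull ℝ s)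
      (T₀.element_subset hs) hxs (by rwa [add_assoc, ← add_smul]) (subset_convexHull ℝ s hz)
      (abs_pos.1 (hρ.trans_le hzρ)) fun w hw => ?_).trans ?_)
    · simp only [add_assoc, ← add_smul]
      simpa only [add_assoc] using h.sq_le_abs_second_difference hG (add_nonneg hx hw.1) hδ
        (by linarith [hw.2]) hS
    · simp only [D, abs_inv]
      gcongr
  calc B.length = 2 / ε * (δ / 2) := by simp only [δ]; field_simp
    _ < 2 / ε * B.slopeVariation G g := by gcongr
    _ ≤ _ := by
        gcongr
        · exact B.slopeVariation_nonneg G g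
        · exact le_add_of_nonneg_left (by positivity)

/-! ### Gradient jumps across the edges of a band -/

theorem sin_angle_mul_norm_mul_norm (r w : Plane) :
    Real.sin (InnerProductGeometry.angle r w) * (‖r‖ * ‖w‖) = |cross r w| := by
  rw [InnerProductGeometry.sin_angle_mul_norm_mul_norm, ← Real.sqrt_sq_eq_abs,
    real_inner_self_eq_norm_sq, real_inner_self_eq_norm_sq, ← cross_sq_add_inner_sq, ← sq,
    add_sub_cancel_right]

theorem inner_nonpos_of_sin_angle_lt {r w : Plane}
    (hθ : Real.pi / 3 ≤ InnerProductGeometry.angle r w)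
    (hsin : Real.sin (InnerProductGeometry.angle r w) < 1 / 2) : inner ℝ r w ≤ 0 := by
  rw [← InnerProductGeometry.cos_angle_mul_norm_mul_norm]
  refine mul_nonpos_of_nonpos_of_nonneg ?_ (by positivity)
  by_contra! hcos
  have hcos_le : Real.cos (InnerProductGeometry.angle r w) ≤ 1 / 2 := by
    rw [← Real.cos_pi_div_three]
    exact Real.cos_le_cos_of_nonneg_of_le_pi (by positivity)
      (InnerProductGeometry.angle_le_pi r w) hθ
  nlinarith [Real.sin_sq_add_cos_sq (InnerProductGeometry.angle r w),
    InnerProductGeometry.sin_angle_nonneg r w]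

theorem abs_cross_le_two_sin_mul_norm {r w g : Plane} (hg : ‖g‖ = 1)
    (hside : 0 < cross g r * cross g w) (hθ : Real.pi / 3 ≤ InnerProductGeometry.angle r w) :
    |cross g w| ≤ 2 * Real.sin (InnerProductGeometry.angle r w) * ‖w‖ := by
  set σ := Real.sin (InnerProductGeometry.angle r w) with hσ_def
  have hσ : 0 ≤ σ := InnerProductGeometry.sin_angle_nonneg r w
  rcases le_or_gt (1 / 2) σ with hlarge | hsmall
  · calc |cross g w| ≤ ‖w‖ := by simpa [hg] using abs_cross_le g w
      _ ≤ 2 * σ * ‖w‖ := le_mul_of_one_le_left (norm_nonneg w) (by linarith)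
  have hr : 0 < ‖r‖ := norm_pos_iff.2 fun h => by simp [h] at hside
  have hw : 0 < |cross g w| := abs_pos.2 (right_ne_zero_of_mul hside.ne')
  have hobtuse := mul_nonpos_of_nonpos_of_nonneg (inner_nonpos_of_sin_angle_lt hθ hsmall) hside.le
  have hid : cross g w ^ 2 * ‖r‖ ^ 2 =
      inner ℝ r w * (cross g r * cross g w) + inner ℝ g r * cross r w * cross g w := by
    simp only [norm_sq_eq, inner_eq, cross_apply]
    ring
  suffices |cross g w| * (|cross g w| * ‖r‖ ^ 2) ≤ |cross g w| * (σ * ‖w‖ * ‖r‖ ^ 2) by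
    have := le_of_mul_le_mul_right (le_of_mul_le_mul_left this hw) (by positivity)
    linarith [mul_nonneg hσ (norm_nonneg w)]
  calc |cross g w| * (|cross g w| * ‖r‖ ^ 2) = cross g w ^ 2 * ‖r‖ ^ 2 := by
        rw [← sq_abs (cross g w)]; ring
    _ ≤ |inner ℝ g r| * |cross r w| * |cross g w| := by
        rw [hid, ← abs_mul, ← abs_mul]
        linarith [le_abs_self (inner ℝ g r * cross r w * cross g w)]
    _ ≤ ‖r‖ * (σ * (‖r‖ * ‖w‖)) * |cross g w| := by
        rw [hσ_def, sin_angle_mul_norm_mul_norm]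
        gcongr
        simpa [hg] using abs_real_inner_le_norm g r
    _ = |cross g w| * (σ * ‖w‖ * ‖r‖ ^ 2) := by ring

theorem abs_inner_le_two_sin_mul_norm {r w g v : Plane} (hg : ‖g‖ = 1)
    (hside : 0 < cross g r * cross g w) (hθ : Real.pi / 3 ≤ InnerProductGeometry.angle r w)
    (horth : inner ℝ v w = 0) :
    |inner ℝ v g| ≤ 2 * Real.sin (InnerProductGeometry.angle r w) * ‖v‖ := by
  have hw : 0 < ‖w‖ := norm_pos_iff.2 fun h => by simp [h] at hside
  have hid : inner ℝ v g * ‖w‖ ^ 2 = inner ℝ v w * inner ℝ g w + cross v w * cross g w := by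
    simp only [norm_sq_eq, inner_eq, cross_apply]
    ring
  refine le_of_mul_le_mul_right ?_ (sq_pos_of_pos hw)
  calc |inner ℝ v g| * ‖w‖ ^ 2 = |cross v w| * |cross g w| := by
        rw [← abs_mul, ← zero_add (cross v w * _), ← zero_mul (inner ℝ g w), ← horth, ← hid,
          abs_mul, abs_sq]
    _ ≤ ‖v‖ * ‖w‖ * (2 * Real.sin (InnerProductGeometry.angle r w) * ‖w‖) := by
        gcongr
        · exact abs_cross_le v w
        · exact abs_cross_le_two_sin_mul_norm hg hside hθ
    _ = 2 * Real.sin (InnerProductGeometry.angle r w) * ‖v‖ * ‖w‖ ^ 2 := by ring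

theorem pi_div_three_le_maxAngle {a b c : Plane} (h : b ≠ a) :
    Real.pi / 3 ≤ maxAngle a b c := by
  have hsum := EuclideanGeometry.angle_add_angle_add_angle_eq_pi c h
  have hA : EuclideanGeometry.angle b a c ≤ maxAngle a b c := le_max_left _ _
  have hB : EuclideanGeometry.angle a b c ≤ maxAngle a b c :=
    (le_max_left _ _).trans (le_max_right _ _)
  have hC : EuclideanGeometry.angle a c b ≤ maxAngle a b c :=
    (le_max_right _ _).trans (le_max_right _ _)
  rw [EuclideanGeometry.angle_comm b c a, EuclideanGeometry.angle_comm c a b] at hsum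
  linarith

namespace Triangulation

variable {Ω : Set Plane} {T : Triangulation Ω} {U : Plane → ℝ} {G : Set Plane → Plane}

theorem volume_real_interior (s : Set Plane) :
    volume.real (interior (convexHull ℝ s)) = area s :=
  measureReal_congr (interior_ae_eq_of_null_frontier
    ((convex_convexHull ℝ s).addHaar_frontier volume))

theorem interior_element_subset (T : Triangulation Ω) {s : Set Plane} (hs : s ∈ T.elements) :
    interior (convexHull ℝ s) ⊆ closure Ω :=
  interior_subset.trans (T.element_subset hs)

theorem sum_setIntegral_le (T : Triangulation Ω) {ι : Type*} [Fintype ι] {e : ι → Set Plane}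
    (he : ∀ i, e i ∈ T.elements) (hinj : Function.Injective e) {φ : Plane → ℝ} (hφ : ∀ x, 0 ≤ φ x)
    (hint : IntegrableOn φ (closure Ω)) :
    ∑ i, ∫ x in interior (convexHull ℝ (e i)), φ x ≤ ∫ x in closure Ω, φ x := by
  have hsub (i) := T.interior_element_subset (he i)
  rw [← integral_iUnion_fintype (fun i => isOpen_interior.measurableSet)
    (fun i j hij => T.pairwiseDisjoint_interior (he i) (he j) (hinj.ne hij))
    (fun i => hint.mono_set (hsub i))]
  exact setIntegral_mono_set hint (ae_of_all _ hφ) (Set.iUnion_subset hsub).eventuallyLE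

namespace IsElementGradient

theorem integrableOn_bound (hG : T.IsElementGradient U G) :
    IntegrableOn (fun x => 2 * ‖gradient (quadratic - U) x‖ ^ 2 + 8 * T.meshSize ^ 2)
      (closure Ω) :=
  (hG.isPiecewiseSmooth.integrableOn_gradient.const_mul 2).add
    (integrableOn_const T.isCompact_closure.measure_ne_top)

theorem norm_sub_sq_le (hG : T.IsElementGradient U G) {s : Set Plane} (hs : s ∈ T.elements)
    {p x : Plane} (hp : p ∈ convexHull ℝ s) (hx : x ∈ interior (convexHull ℝ s)) :
    ‖(2 : ℝ) • p - G s‖ ^ 2 ≤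
      2 * ‖gradient (quadratic - U) x‖ ^ 2 + 8 * T.meshSize ^ 2 := by
  rw [(hG.hasGradientAt hs hx).gradient]
  have hdist := T.dist_le_meshSize hs hp (interior_subset hx)
  rw [dist_eq_norm] at hdist
  calc ‖(2 : ℝ) • p - G s‖ ^ 2 = ‖((2 : ℝ) • x - G s) + (2 : ℝ) • (p - x)‖ ^ 2 := by
        congr 2; module
    _ ≤ (‖(2 : ℝ) • x - G s‖ + ‖(2 : ℝ) • (p - x)‖) ^ 2 := by
        gcongr
        exact norm_add_le _ _
    _ ≤ 2 * (‖(2 : ℝ) • x - G s‖ ^ 2 + ‖(2 : ℝ) • (p - x)‖ ^ 2) := add_sq_le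
    _ = 2 * ‖(2 : ℝ) • x - G s‖ ^ 2 + 8 * ‖p - x‖ ^ 2 := by
        rw [norm_smul, Real.norm_of_nonneg zero_le_two]; ring
    _ ≤ _ := by gcongr

theorem area_mul_sq_le (hG : T.IsElementGradient U G) {s : Set Plane} (hs : s ∈ T.elements)
    {p : Plane} (hp : p ∈ convexHull ℝ s) :
    area s * ‖(2 : ℝ) • p - G s‖ ^ 2 ≤ ∫ x in interior (convexHull ℝ s),
      (2 * ‖gradient (quadratic - U) x‖ ^ 2 + 8 * T.meshSize ^ 2) := by
  have hsub := T.interior_element_subset hs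
  rw [← volume_real_interior, ← smul_eq_mul, ← setIntegral_const]
  exact setIntegral_mono_on
    (integrableOn_const (measure_ne_top_of_subset hsub T.isCompact_closure.measure_ne_top))
    (hG.integrableOn_bound.mono_set hsub) isOpen_interior.measurableSet
    fun x hx => hG.norm_sub_sq_le hs hp hx

theorem sum_area_mul_sq_le (hG : T.IsElementGradient U G) {ι : Type*} [Fintype ι]
    {e : ι → Set Plane} (he : ∀ i, e i ∈ T.elements) (hinj : Function.Injective e)
    {p : ι → Plane} (hp : ∀ i, p i ∈ e i) :
    ∑ i, area (e i) * ‖(2 : ℝ) • p i - G (e i)‖ ^ 2 ≤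
      2 * h1Seminorm (closure Ω) (quadratic - U) ^ 2 +
        8 * T.meshSize ^ 2 * volume.real (closure Ω) := by
  calc ∑ i, area (e i) * ‖(2 : ℝ) • p i - G (e i)‖ ^ 2
      ≤ ∫ x in closure Ω, (2 * ‖gradient (quadratic - U) x‖ ^ 2 + 8 * T.meshSize ^ 2) :=
        (Finset.sum_le_sum fun i _ => hG.area_mul_sq_le (he i) (subset_convexHull ℝ _ (hp i))).trans
          (T.sum_setIntegral_le he hinj (fun x => by positivity) hG.integrableOn_bound)
    _ = _ := by
        rw [integral_add (hG.isPiecewiseSmooth.integrableOn_gradient.const_mul 2)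
          (integrableOn_const T.isCompact_closure.measure_ne_top), integral_const_mul,
          setIntegral_const, h1Seminorm, Real.sq_sqrt (integral_nonneg fun x => by positivity),
          smul_eq_mul, mul_comm (volume.real _)]

theorem inner_sub_eq_zero (hG : T.IsElementGradient U G) {s t : Set Plane}
    (hs : s ∈ T.elements) (ht : t ∈ T.elements) {x y : Plane} (hxs : x ∈ s) (hys : y ∈ s)
    (hxt : x ∈ t) (hyt : y ∈ t) : inner ℝ (G s - G t) (y - x) = 0 := by
  rw [inner_sub_left, ← hG.sub_eq s hs x (subset_convexHull ℝ _ hxs) y (subset_convexHull ℝ _ hys),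
    ← hG.sub_eq t ht x (subset_convexHull ℝ _ hxt) y (subset_convexHull ℝ _ hyt), sub_self]

end IsElementGradient

end Triangulation

namespace Band

variable {Ω : Set Plane} {T : Triangulation Ω} {N : ℕ} {B : Band T N}
  {U : Plane → ℝ} {G : Set Plane → Plane} {g : Plane} {t : Fin (N + 2) → ℝ}

namespace IsArclength

theorem cross_sub_P_eq (h : B.IsArclength g t) (x : Plane) (k l : Fin (N + 2)) :
    cross g (x - B.P k) = cross g (x - B.P l) := by
  rw [← sub_add_sub_cancel x (B.P l) (B.P k), map_add, h.sub_eq, map_smul, cross_self, smul_zero,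
    add_zero]

theorem cross_Q_ne_zero (h : B.IsArclength g t) (i : Fin (N + 1)) (k : Fin (N + 2)) :
    cross g (B.Q i - B.P k) ≠ 0 := by
  intro hzero
  rw [h.cross_sub_P_eq _ k i.castSucc] at hzero
  refine (T.area_pos (B.mem_K i)).ne' ?_
  rw [area_eq, h.sub_eq, map_smul, cross_comm, hzero, neg_zero, smul_zero, abs_zero, zero_div]

theorem cross_eq_zero_of_mem_affineSpan (h : B.IsArclength g t) {x : Plane}
    (hx : x ∈ affineSpan ℝ (Set.range B.P)) (k : Fin (N + 2)) : cross g (x - B.P k) = 0 := by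
  refine affineSpan_induction (p := fun x => cross g (x - B.P k) = 0) hx ?_ ?_
  · rintro _ ⟨l, rfl⟩
    rw [h.sub_eq, map_smul, cross_self, smul_zero]
  · intro c u v w hu hv hw
    rw [show (c • (u -ᵥ v) +ᵥ w) - B.P k = c • ((u - B.P k) - (v - B.P k)) + (w - B.P k) by
      rw [vsub_eq_sub, vadd_eq_add]; module, map_add, map_smul, map_sub, hu, hv, hw]
    simp

theorem cross_mul_cross_pos (h : B.IsArclength g t) (i j : Fin (N + 1)) (k : Fin (N + 2)) :
    0 < cross g (B.Q i - B.P k) * cross g (B.Q j - B.P k) := by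
  obtain ⟨-, -, p, hp, hray⟩ := (AffineSubspace.sSameSide_iff_exists_left
    (mem_affineSpan ℝ (Set.mem_range_self k))).1 (B.oneSide i j)
  have hp_line : cross g (B.Q j -ᵥ p) = cross g (B.Q j - B.P k) := by
    rw [vsub_eq_sub, ← sub_sub_sub_cancel_right (B.Q j) p (B.P k), map_sub,
      h.cross_eq_zero_of_mem_affineSpan hp, sub_zero]
  have hray_cross := hray.map (cross g)
  rw [hp_line, vsub_eq_sub] at hray_cross
  have hj := h.cross_Q_ne_zero j k
  obtain ⟨a, b, ha, hb, hab⟩ := hray_cross.exists_pos (h.cross_Q_ne_zero i k) hj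
  refine pos_of_mul_pos_right (a := a) ?_ ha.le
  rw [← mul_assoc, ← smul_eq_mul a, hab, smul_eq_mul, mul_assoc]
  exact mul_pos hb (mul_self_pos.2 hj)

end IsArclength

theorem P_injective (B : Band T N) : Function.Injective B.P := by
  obtain ⟨g, t, h⟩ := B.exists_isArclength
  intro i j hij
  have hsub := h.sub_eq i j
  rw [hij, sub_self, eq_comm, smul_eq_zero, sub_eq_zero] at hsub
  exact h.strictMono.injective (hsub.resolve_right fun hg => by simpa [hg] using h.norm_dir).symm

theorem P_ne_Q (B : Band T N) (i : Fin (N + 2)) (j : Fin (N + 1)) : B.P i ≠ B.Q j := by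
  obtain ⟨g, t, h⟩ := B.exists_isArclength
  intro hij
  refine h.cross_Q_ne_zero j i ?_
  rw [hij, sub_self, map_zero]

theorem K_injective (B : Band T N) : Function.Injective B.K := by
  have hle {i j : Fin (N + 1)} (hij : B.K i = B.K j) : j ≤ i := by
    have hmem : B.P i.castSucc ∈ B.K j := hij ▸ Set.mem_insert _ _
    rcases hmem with hP | hQ | hP
    · exact (Fin.castSucc_injective _ (B.P_injective hP)).ge
    · exact absurd hQ (B.P_ne_Q _ _)
    · exact (Fin.castSucc_lt_castSucc_iff.1
        (Fin.castSucc_lt_succ.trans_eq (B.P_injective hP).symm)).le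
  exact fun i j hij => le_antisymm (hle hij.symm) (hle hij)

theorem Ktilde_injective (B : Band T N) : Function.Injective B.Ktilde := by
  intro i j hij
  have hmem : B.P i.succ.castSucc ∈ B.Ktilde j := by
    rw [← hij]
    simp [Ktilde]
  rcases hmem with hQ | hP | hQ
  · exact absurd hQ (B.P_ne_Q _ _)
  · exact Fin.succ_injective _ (Fin.castSucc_injective _ (B.P_injective hP))
  · exact absurd hQ (B.P_ne_Q _ _)

theorem alphaTilde_eq (B : Band T N) (i : Fin N) : B.alphaTilde i =
    InnerProductGeometry.angle (B.Q i.castSucc - B.P i.succ.castSucc)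
      (B.Q i.succ - B.P i.succ.castSucc) :=
  B.maxAngle_Ktilde i

theorem sin_alphaTilde_nonneg (B : Band T N) (i : Fin N) :
    0 ≤ Real.sin (Real.pi - B.alphaTilde i) := by
  rw [Real.sin_pi_sub, alphaTilde_eq]
  exact InnerProductGeometry.sin_angle_nonneg _ _

theorem pi_div_three_le_alphaTilde (B : Band T N) (i : Fin N) :
    Real.pi / 3 ≤ B.alphaTilde i :=
  pi_div_three_le_maxAngle (B.P_ne_Q _ _)

/-- The total size of the jumps of the gradient across the two edges that the element `Ktilde i`
shares with its neighbours `K i` and `K (i + 1)` in the band. -/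
noncomputable def gradientJump (B : Band T N) (G : Set Plane → Plane) (i : Fin N) : ℝ :=
  ‖G (B.K i.succ) - G (B.Ktilde i)‖ + ‖G (B.Ktilde i) - G (B.K i.castSucc)‖

/-- The part of `Comparable` that bounds the area of `Ktilde i` by the areas of its two neighbours
`K i` and `K (i + 1)` in the band. -/
def AreaComparable (B : Band T N) (c : ℝ) : Prop :=
  ∀ i : Fin N, area (B.Ktilde i) ≤ c * area (B.K i.succ) ∧
    area (B.Ktilde i) ≤ c * area (B.K i.castSucc)

/-- The minimum of `1 / sin (π - α̃ i)` times the minimum of `|K̃ i| ^ (1 / 2)`: the factor of the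
band estimate that is large when the elements `K̃ i` are degenerate. -/
noncomputable def flatness (B : Band T N) : ℝ :=
  (⨅ i : Fin N, 1 / Real.sin (Real.pi - B.alphaTilde i)) * ⨅ i : Fin N, √(area (B.Ktilde i))

theorem flatness_nonneg (B : Band T N) : 0 ≤ B.flatness :=
  mul_nonneg (Real.iInf_nonneg fun i => one_div_nonneg.2 (B.sin_alphaTilde_nonneg i))
    (Real.iInf_nonneg fun _ => Real.sqrt_nonneg _)

theorem flatness_mul_sin_le (B : Band T N) (i : Fin N) :
    B.flatness * Real.sin (Real.pi - B.alphaTilde i) ≤ √(area (B.Ktilde i)) := by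
  have hsin := B.sin_alphaTilde_nonneg i
  have harea : 0 ≤ ⨅ i : Fin N, √(area (B.Ktilde i)) := Real.iInf_nonneg fun _ => Real.sqrt_nonneg _
  calc B.flatness * Real.sin (Real.pi - B.alphaTilde i)
      ≤ 1 / Real.sin (Real.pi - B.alphaTilde i) * (⨅ i : Fin N, √(area (B.Ktilde i))) *
          Real.sin (Real.pi - B.alphaTilde i) := by
        rw [flatness]
        gcongr
        exact ciInf_le (Set.finite_range _).bddBelow i
    _ = 1 / Real.sin (Real.pi - B.alphaTilde i) * Real.sin (Real.pi - B.alphaTilde i) *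
          ⨅ i : Fin N, √(area (B.Ktilde i)) := by ring
    _ ≤ 1 * ⨅ i : Fin N, √(area (B.Ktilde i)) := by
        gcongr
        rw [one_div_mul_eq_div]
        exact div_self_le_one _
    _ ≤ √(area (B.Ktilde i)) := by
        rw [one_mul]
        exact ciInf_le (Set.finite_range _).bddBelow i

theorem IsArclength.abs_slope_sub_le (h : B.IsArclength g t) (hG : T.IsElementGradient U G)
    (i : Fin N) :
    |inner ℝ (G (B.K i.succ)) g - inner ℝ (G (B.K i.castSucc)) g| ≤
      2 * Real.sin (Real.pi - B.alphaTilde i) * B.gradientJump G i := by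
  have hθ := B.pi_div_three_le_alphaTilde i
  rw [alphaTilde_eq] at hθ
  have hnext : |inner ℝ (G (B.K i.succ) - G (B.Ktilde i)) g| ≤
      2 * Real.sin (B.alphaTilde i) * ‖G (B.K i.succ) - G (B.Ktilde i)‖ := by
    rw [alphaTilde_eq]
    exact abs_inner_le_two_sin_mul_norm h.norm_dir (h.cross_mul_cross_pos _ _ _) hθ
      (hG.inner_sub_eq_zero (B.mem_K i.succ) (B.mem_Ktilde i) (by simp) (by simp) (by simp)
        (by simp))
  have hprev : |inner ℝ (G (B.Ktilde i) - G (B.K i.castSucc)) g| ≤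
      2 * Real.sin (B.alphaTilde i) * ‖G (B.Ktilde i) - G (B.K i.castSucc)‖ := by
    rw [alphaTilde_eq, InnerProductGeometry.angle_comm]
    rw [InnerProductGeometry.angle_comm] at hθ
    exact abs_inner_le_two_sin_mul_norm h.norm_dir (h.cross_mul_cross_pos _ _ _) hθ
      (hG.inner_sub_eq_zero (B.mem_Ktilde i) (B.mem_K i.castSucc) (by simp) (by simp)
        (by simp) (by simp))
  rw [← inner_sub_left, ← sub_add_sub_cancel _ (G (B.Ktilde i)), inner_add_left, Real.sin_pi_sub,
    gradientJump, mul_add]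
  exact (abs_add_le _ _).trans (add_le_add hnext hprev)

theorem gradientJump_sq_le (B : Band T N) (G : Set Plane → Plane) (i : Fin N) (q : Plane) :
    B.gradientJump G i ^ 2 ≤ 4 * ‖q - G (B.K i.succ)‖ ^ 2 + 8 * ‖q - G (B.Ktilde i)‖ ^ 2 +
      4 * ‖q - G (B.K i.castSucc)‖ ^ 2 := by
  have hnext : ‖G (B.K i.succ) - G (B.Ktilde i)‖ ≤
      ‖q - G (B.K i.succ)‖ + ‖q - G (B.Ktilde i)‖ := by
    simpa only [dist_eq_norm] using dist_triangle_left (G (B.K i.succ)) (G (B.Ktilde i)) q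
  have hprev : ‖G (B.Ktilde i) - G (B.K i.castSucc)‖ ≤
      ‖q - G (B.Ktilde i)‖ + ‖q - G (B.K i.castSucc)‖ := by
    simpa only [dist_eq_norm] using dist_triangle_left (G (B.Ktilde i)) (G (B.K i.castSucc)) q
  calc B.gradientJump G i ^ 2
      ≤ (‖q - G (B.K i.succ)‖ + ‖q - G (B.Ktilde i)‖ +
          (‖q - G (B.Ktilde i)‖ + ‖q - G (B.K i.castSucc)‖)) ^ 2 := by
        rw [gradientJump]
        gcongr
    _ ≤ 2 * (2 * (‖q - G (B.K i.succ)‖ ^ 2 + ‖q - G (B.Ktilde i)‖ ^ 2) +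
          2 * (‖q - G (B.Ktilde i)‖ ^ 2 + ‖q - G (B.K i.castSucc)‖ ^ 2)) := by
        refine add_sq_le.trans ?_
        gcongr <;> exact add_sq_le
    _ = _ := by ring

theorem AreaComparable.sum_area_mul_gradientJump_sq_le {c : ℝ} (hB : B.AreaComparable c)
    (hc : 0 ≤ c) (hG : T.IsElementGradient U G) :
    ∑ i, area (B.Ktilde i) * B.gradientJump G i ^ 2 ≤
      8 * (c + 1) * (2 * h1Seminorm (closure Ω) (quadratic - U) ^ 2 +
        8 * T.meshSize ^ 2 * volume.real (closure Ω)) := by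
  set q : Fin N → Plane := fun i => B.P i.succ.castSucc
  have hnext := hG.sum_area_mul_sq_le (e := fun i : Fin N => B.K i.succ) (p := q)
    (fun i => B.mem_K i.succ) (B.K_injective.comp (Fin.succ_injective _)) (fun i => by simp [q, K])
  have hmid := hG.sum_area_mul_sq_le (e := B.Ktilde) (p := q)
    B.mem_Ktilde B.Ktilde_injective (fun i => by simp [q, Ktilde])
  have hprev := hG.sum_area_mul_sq_le (e := fun i : Fin N => B.K i.castSucc) (p := q)
    (fun i => B.mem_K i.castSucc) (B.K_injective.comp (Fin.castSucc_injective _))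
    (fun i => by simp [q, K])
  set W := 2 * h1Seminorm (closure Ω) (quadratic - U) ^ 2 +
    8 * T.meshSize ^ 2 * volume.real (closure Ω)
  calc ∑ i, area (B.Ktilde i) * B.gradientJump G i ^ 2
      ≤ ∑ i, (4 * c * (area (B.K i.succ) * ‖(2 : ℝ) • q i - G (B.K i.succ)‖ ^ 2) +
          8 * (area (B.Ktilde i) * ‖(2 : ℝ) • q i - G (B.Ktilde i)‖ ^ 2) +
          4 * c * (area (B.K i.castSucc) * ‖(2 : ℝ) • q i - G (B.K i.castSucc)‖ ^ 2)) := by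
        refine Finset.sum_le_sum fun i _ => ?_
        have hjump := mul_le_mul_of_nonneg_left (B.gradientJump_sq_le G i ((2 : ℝ) • q i))
          (area_nonneg (B.Ktilde i))
        have hsucc := mul_le_mul_of_nonneg_right (hB i).1
          (sq_nonneg ‖(2 : ℝ) • q i - G (B.K i.succ)‖)
        have hcast := mul_le_mul_of_nonneg_right (hB i).2
          (sq_nonneg ‖(2 : ℝ) • q i - G (B.K i.castSucc)‖)
        linarith
    _ ≤ 4 * c * W + 8 * W + 4 * c * W := by
        simp only [Finset.sum_add_distrib, ← Finset.mul_sum]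
        gcongr
    _ = 8 * (c + 1) * W := by ring

theorem AreaComparable.flatness_mul_slopeVariation_sq_le {c : ℝ} (hB : B.AreaComparable c)
    (hc : 0 ≤ c) (hG : T.IsElementGradient U G) (h : B.IsArclength g t) :
    (B.flatness * B.slopeVariation G g) ^ 2 ≤
      N * (32 * (c + 1) * (2 * h1Seminorm (closure Ω) (quadratic - U) ^ 2 +
        8 * T.meshSize ^ 2 * volume.real (closure Ω))) := by
  have hterm (i : Fin N) :
      B.flatness * |inner ℝ (G (B.K i.succ)) g - inner ℝ (G (B.K i.castSucc)) g| ≤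
        2 * (√(area (B.Ktilde i)) * B.gradientJump G i) := by
    have hjump : 0 ≤ B.gradientJump G i := add_nonneg (norm_nonneg _) (norm_nonneg _)
    calc B.flatness * |inner ℝ (G (B.K i.succ)) g - inner ℝ (G (B.K i.castSucc)) g|
        ≤ B.flatness * (2 * Real.sin (Real.pi - B.alphaTilde i) * B.gradientJump G i) :=
          mul_le_mul_of_nonneg_left (h.abs_slope_sub_le hG i) B.flatness_nonneg
      _ = 2 * (B.flatness * Real.sin (Real.pi - B.alphaTilde i) * B.gradientJump G i) := by ring
      _ ≤ 2 * (√(area (B.Ktilde i)) * B.gradientJump G i) := by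
          gcongr
          exact B.flatness_mul_sin_le i
  calc (B.flatness * B.slopeVariation G g) ^ 2
      ≤ (∑ i, 2 * (√(area (B.Ktilde i)) * B.gradientJump G i)) ^ 2 := by
        refine pow_le_pow_left₀ (mul_nonneg B.flatness_nonneg (B.slopeVariation_nonneg G g)) ?_ 2
        rw [slopeVariation, Finset.mul_sum]
        exact Finset.sum_le_sum fun i _ => hterm i
    _ ≤ (N : ℝ) * ∑ i, (2 * (√(area (B.Ktilde i)) * B.gradientJump G i)) ^ 2 := by
        simpa using sq_sum_le_card_mul_sum_sq (s := (Finset.univ : Finset (Fin N)))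
          (f := fun i => 2 * (√(area (B.Ktilde i)) * B.gradientJump G i))
    _ = (N : ℝ) * (4 * ∑ i, area (B.Ktilde i) * B.gradientJump G i ^ 2) := by
        simp only [mul_pow, Real.sq_sqrt (area_nonneg _), ← Finset.mul_sum]
        norm_num
    _ ≤ (N : ℝ) * (32 * (c + 1) * (2 * h1Seminorm (closure Ω) (quadratic - U) ^ 2 +
          8 * T.meshSize ^ 2 * volume.real (closure Ω))) := by
        refine mul_le_mul_of_nonneg_left ?_ N.cast_nonneg
        linarith [hB.sum_area_mul_gradientJump_sq_le hc hG]

end Band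

/-! ### The estimates -/

theorem Triangulation.meshSize_le_mul_rpow {Ω : Set Plane} (T : Triangulation Ω) {s : Set Plane}
    (hs : s ∈ T.elements) {α : ℝ} (hα : α ≤ 1) :
    T.meshSize ≤ Metric.diam (closure Ω) ^ (1 - α) * T.meshSize ^ α := by
  have hmesh := T.meshSize_pos hs
  calc T.meshSize = T.meshSize ^ (1 - α) * T.meshSize ^ α := by
        rw [← Real.rpow_add hmesh, sub_add_cancel, Real.rpow_one]
    _ ≤ Metric.diam (closure Ω) ^ (1 - α) * T.meshSize ^ α := by
        gcongr
        exact T.meshSize_le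

namespace Band

variable {Ω : Set Plane} {T : Triangulation Ω} {N : ℕ} {B : Band T N} {U : Plane → ℝ}

theorem AreaComparable.flatness_mul_le {G : Set Plane → Plane} {g : Plane}
    {t : Fin (N + 2) → ℝ} {c C_u α : ℝ} (hB : B.AreaComparable c) (hc : 0 ≤ c)
    (hG : T.IsElementGradient U G) (h : B.IsArclength g t) (hα : α ≤ 1)
    (herr : h1Seminorm (closure Ω) (quadratic - U) ≤ C_u * T.meshSize ^ α) :
    B.flatness * B.slopeVariation G g ≤ √N * (√(32 * (c + 1) * (2 * C_u ^ 2 +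
      8 * (Metric.diam (closure Ω) ^ (1 - α)) ^ 2 * volume.real (closure Ω))) *
        T.meshSize ^ α) := by
  have hmesh := T.meshSize_pos (B.mem_K 0)
  have hmesh_le := T.meshSize_le_mul_rpow (B.mem_K 0) hα
  have herr_nonneg : 0 ≤ h1Seminorm (closure Ω) (quadratic - U) := Real.sqrt_nonneg _
  set X := 32 * (c + 1) * (2 * C_u ^ 2 +
    8 * (Metric.diam (closure Ω) ^ (1 - α)) ^ 2 * volume.real (closure Ω))
  have hX : 0 ≤ X := by positivity
  refine le_of_sq_le_sq ?_ (by positivity)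
  calc (B.flatness * B.slopeVariation G g) ^ 2
      ≤ N * (32 * (c + 1) * (2 * h1Seminorm (closure Ω) (quadratic - U) ^ 2 +
          8 * T.meshSize ^ 2 * volume.real (closure Ω))) :=
        hB.flatness_mul_slopeVariation_sq_le hc hG h
    _ ≤ N * (32 * (c + 1) * (2 * (C_u * T.meshSize ^ α) ^ 2 +
          8 * (Metric.diam (closure Ω) ^ (1 - α) * T.meshSize ^ α) ^ 2 *
            volume.real (closure Ω))) := by
        gcongr
    _ = N * (X * (T.meshSize ^ α) ^ 2) := by ring
    _ = (√N * (√X * T.meshSize ^ α)) ^ 2 := by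
        rw [mul_pow, mul_pow, Real.sq_sqrt N.cast_nonneg, Real.sq_sqrt hX]

theorem exists_flatness_mul_length_le (Ω : Set Plane) :
    ∃ A > 0, ∀ α : ℝ, α ≤ 1 → ∀ C_u > 0, ∀ c ≥ 0, ∃ C > 0, ∀ T : Triangulation Ω, ∀ U ∈ T.feSpace,
      h1Seminorm (closure Ω) (quadratic - U) ≤ C_u * T.meshSize ^ α →
      ∀ {N : ℕ} {B : Band T N}, B.AreaComparable c →
        A * C_u ^ (2 / 5 : ℝ) * T.meshSize ^ (2 * α / 5) ≤ B.length →
        B.flatness * B.length ≤ √N * (C * T.meshSize ^ α) := by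
  obtain ⟨κ, hκ, hlength⟩ := exists_length_lt_mul_slopeVariation Ω
  refine ⟨κ + 1, by positivity, fun α hα C_u hCu c hc => ?_⟩
  set X := 32 * (c + 1) * (2 * C_u ^ 2 +
    8 * (Metric.diam (closure Ω) ^ (1 - α)) ^ 2 * volume.real (closure Ω))
  refine ⟨κ * √X, by positivity, fun T U hU herr N B hB hL => ?_⟩
  obtain ⟨G, hG⟩ := T.exists_isElementGradient hU
  obtain ⟨g, t, h⟩ := B.exists_isArclength
  have hmesh := T.meshSize_pos (B.mem_K 0)
  have herr_nonneg : 0 ≤ h1Seminorm (closure Ω) (quadratic - U) := Real.sqrt_nonneg _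
  have hlong : κ * h1Seminorm (closure Ω) (quadratic - U) ^ 2 < B.length ^ 5 := calc
    κ * h1Seminorm (closure Ω) (quadratic - U) ^ 2
      ≤ κ * (C_u * T.meshSize ^ α) ^ 2 := by gcongr
    _ < (κ + 1) ^ 5 * (C_u * T.meshSize ^ α) ^ 2 := by
        gcongr
        exact (lt_add_one κ).trans_le (le_self_pow₀ (by linarith) (by norm_num))
    _ = ((κ + 1) * C_u ^ (2 / 5 : ℝ) * T.meshSize ^ (2 * α / 5)) ^ 5 := by
        simp only [mul_pow, ← Real.rpow_mul_natCast hCu.le, ← Real.rpow_mul_natCast hmesh.le]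
        norm_num
        ring_nf
    _ ≤ B.length ^ 5 := by gcongr
  calc B.flatness * B.length
      ≤ B.flatness * (κ * B.slopeVariation G g) :=
        mul_le_mul_of_nonneg_left (hlength T hG B h hlong).le B.flatness_nonneg
    _ = κ * (B.flatness * B.slopeVariation G g) := by ring
    _ ≤ κ * (√N * (√X * T.meshSize ^ α)) := by
        refine mul_le_mul_of_nonneg_left ?_ hκ.le
        exact hB.flatness_mul_le hc hG h hα herr
    _ = √N * (κ * √X * T.meshSize ^ α) := by ring

theorem AreaComparable.mono {c c' : ℝ} (hB : B.AreaComparable c) (hc : c ≤ c') :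
    B.AreaComparable c' := fun i =>
  ⟨(hB i).1.trans (mul_le_mul_of_nonneg_right hc (area_nonneg _)),
    (hB i).2.trans (mul_le_mul_of_nonneg_right hc (area_nonneg _))⟩

theorem Comparable.areaComparable {C_K C_α : ℝ} (hB : B.Comparable C_K C_α) :
    B.AreaComparable C_K :=
  fun i => ⟨(hB i).1, (hB i).2.1⟩

namespace IsRegularIsosceles

variable {b hbar : ℝ}

theorem exists_frame (h : B.IsRegularIsosceles b hbar) :
    ∃ g n : Plane, ‖g‖ = 1 ∧ ‖n‖ = 1 ∧ inner ℝ g n = 0 ∧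
      (∀ i : Fin (N + 1), B.P i.succ - B.P i.castSucc = b • g ∧
        B.Q i - B.P i.castSucc = (b / 2) • g + hbar • n) ∧
      ∀ i : Fin N, B.Q i.castSucc - B.P i.succ.castSucc = -(b / 2) • g + hbar • n := by
  obtain ⟨-, g, n, hg, hn, hgn, hP, hQ⟩ := h
  refine ⟨g, n, hg, hn, hgn, fun i => ⟨?_, by rw [hQ]; abel⟩, fun i => ?_⟩
  · rw [hP i.succ, hP i.castSucc, Fin.val_succ, Fin.val_castSucc]
    push_cast
    module
  · rw [hQ, hP i.succ.castSucc, hP i.castSucc.castSucc]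
    simp only [Fin.val_succ, Fin.val_castSucc]
    push_cast
    module

theorem length_eq (h : B.IsRegularIsosceles b hbar) (hb : 0 ≤ b) : B.length = (N + 1) * b := by
  obtain ⟨g, n, hg, -, -, hedge, -⟩ := h.exists_frame
  have hdist (i : Fin (N + 1)) : dist (B.P i.castSucc) (B.P i.succ) = b := by
    rw [dist_comm, dist_eq_norm, (hedge i).1, norm_smul, hg, mul_one, Real.norm_of_nonneg hb]
  simp [length, hdist]

theorem area_K (h : B.IsRegularIsosceles b hbar) (hb : 0 ≤ b) (i : Fin (N + 1)) :
    area (B.K i) = b * hbar / 2 := by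
  obtain ⟨g, n, hg, hn, hgn, hedge, -⟩ := h.exists_frame
  have hcross := cross_smul_add_smul g n (b / 2) hbar b 0
  rw [zero_smul, add_zero] at hcross
  rw [K, area_eq, (hedge i).1, (hedge i).2, hcross, abs_mul,
    abs_cross_eq_one_of_orthonormal hg hn hgn, mul_zero, zero_sub, abs_neg, mul_one,
    abs_of_nonneg (mul_nonneg h.1.le hb), mul_comm]

theorem abs_cross_Ktilde (h : B.IsRegularIsosceles b hbar) (hb : 0 ≤ b) (i : Fin N) :
    |cross (B.Q i.castSucc - B.P i.succ.castSucc) (B.Q i.succ - B.P i.succ.castSucc)| =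
      b * hbar := by
  obtain ⟨g, n, hg, hn, hgn, hedge, hback⟩ := h.exists_frame
  rw [hback, (hedge i.succ).2, cross_smul_add_smul, abs_mul,
    abs_cross_eq_one_of_orthonormal hg hn hgn, mul_one, ← abs_neg,
    ← abs_of_nonneg (mul_nonneg hb h.1.le)]
  ring_nf

theorem area_Ktilde (h : B.IsRegularIsosceles b hbar) (hb : 0 ≤ b) (i : Fin N) :
    area (B.Ktilde i) = b * hbar / 2 := by
  rw [Ktilde, Set.insert_comm, area_eq, h.abs_cross_Ktilde hb]

theorem areaComparable_one (h : B.IsRegularIsosceles b hbar) (hb : 0 ≤ b) :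
    B.AreaComparable 1 := fun i => by
  rw [h.area_Ktilde hb, h.area_K hb, h.area_K hb, one_mul]
  exact ⟨le_rfl, le_rfl⟩

theorem half_base_le_norm (h : B.IsRegularIsosceles b hbar) (i : Fin N) :
    b / 2 ≤ ‖B.Q i.castSucc - B.P i.succ.castSucc‖ ∧
      b / 2 ≤ ‖B.Q i.succ - B.P i.succ.castSucc‖ := by
  obtain ⟨g, n, hg, -, hgn, hedge, hback⟩ := h.exists_frame
  have hinner (a : ℝ) : inner ℝ (a • g + hbar • n) g = a := by
    rw [inner_add_left, real_inner_smul_left, real_inner_smul_left, real_inner_self_eq_norm_sq, hg,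
      real_inner_comm, hgn]
    ring
  have hle (a : ℝ) : |a| ≤ ‖a • g + hbar • n‖ := by
    simpa [hinner, hg] using abs_real_inner_le_norm (a • g + hbar • n) g
  rw [hback, (hedge i.succ).2]
  exact ⟨(le_abs_self _).trans ((abs_neg _).ge.trans (hle _)), (le_abs_self _).trans (hle _)⟩

theorem sin_alphaTilde_pos (h : B.IsRegularIsosceles b hbar) (hb : 0 < b) (i : Fin N) :
    0 < Real.sin (Real.pi - B.alphaTilde i) := by
  have hsin := sin_angle_mul_norm_mul_norm (B.Q i.castSucc - B.P i.succ.castSucc)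
    (B.Q i.succ - B.P i.succ.castSucc)
  rw [h.abs_cross_Ktilde hb.le, ← alphaTilde_eq, ← Real.sin_pi_sub] at hsin
  exact pos_of_mul_pos_left (hsin ▸ mul_pos hb h.1) (by positivity)

theorem sin_alphaTilde_le (h : B.IsRegularIsosceles b hbar) (hb : 0 < b) (i : Fin N) :
    Real.sin (Real.pi - B.alphaTilde i) ≤ 4 * hbar / b := by
  obtain ⟨hleft, hright⟩ := h.half_base_le_norm i
  have hsin := sin_angle_mul_norm_mul_norm (B.Q i.castSucc - B.P i.succ.castSucc)
    (B.Q i.succ - B.P i.succ.castSucc)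
  rw [h.abs_cross_Ktilde hb.le, ← alphaTilde_eq, ← Real.sin_pi_sub] at hsin
  have hle : Real.sin (Real.pi - B.alphaTilde i) * (b / 2 * (b / 2)) ≤ b * hbar := by
    rw [← hsin]
    gcongr
    exact B.sin_alphaTilde_nonneg i
  rw [le_div_iff₀ hb]
  exact le_of_mul_le_mul_right (by linarith) hb

theorem le_flatness [NeZero N] (h : B.IsRegularIsosceles b hbar) (hb : 0 < b) :
    b / (4 * hbar) * √(b * hbar / 2) ≤ B.flatness := by
  have hsin : b / (4 * hbar) ≤ ⨅ i : Fin N, 1 / Real.sin (Real.pi - B.alphaTilde i) :=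
    le_ciInf fun i => by
      rw [← one_div_div]
      exact one_div_le_one_div_of_le (h.sin_alphaTilde_pos hb i) (h.sin_alphaTilde_le hb i)
  have hpos := h.1
  rw [flatness]
  refine mul_le_mul hsin (le_ciInf fun i => ?_) (Real.sqrt_nonneg _) (le_trans ?_ hsin)
  · rw [h.area_Ktilde hb.le]
  · positivity

theorem le_height [NeZero N] (h : B.IsRegularIsosceles b hbar) (hb : 0 < b) {C α : ℝ} (hC : 0 < C)
    (hest : B.flatness * B.length ≤ √N * (C * b ^ α)) :
    1 / (32 * C ^ 2) * b ^ (4 - 2 * α) * B.length ≤ hbar := by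
  have hpos := h.1
  have hlen := h.length_eq hb.le
  have hlength : 0 < B.length := by rw [hlen]; positivity
  have hNb : N * b ≤ B.length := by rw [hlen]; gcongr; linarith
  have : 0 < b ^ α := Real.rpow_pos_of_pos hb _
  have hsq : b ^ 3 / (32 * hbar) * B.length ^ 2 ≤ N * (C * b ^ α) ^ 2 := calc
    b ^ 3 / (32 * hbar) * B.length ^ 2
      = (b / (4 * hbar) * √(b * hbar / 2) * B.length) ^ 2 := by
        rw [mul_pow, mul_pow, Real.sq_sqrt (by positivity)]
        field_simp
        ring
    _ ≤ (√N * (C * b ^ α)) ^ 2 := by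
        refine pow_le_pow_left₀ (by positivity) ?_ 2
        exact (mul_le_mul_of_nonneg_right (h.le_flatness hb) hlength.le).trans hest
    _ = N * (C * b ^ α) ^ 2 := by rw [mul_pow, Real.sq_sqrt N.cast_nonneg]
  have hmul : b ^ 4 * B.length * B.length ≤ 32 * hbar * (C * b ^ α) ^ 2 * B.length := calc
    b ^ 4 * B.length * B.length
      = 32 * hbar * b * (b ^ 3 / (32 * hbar) * B.length ^ 2) := by field_simp
    _ ≤ 32 * hbar * b * (N * (C * b ^ α) ^ 2) := by gcongr
    _ = 32 * hbar * (C * b ^ α) ^ 2 * (N * b) := by ring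
    _ ≤ 32 * hbar * (C * b ^ α) ^ 2 * B.length := by gcongr
  have hsplit : b ^ (4 - 2 * α) = b ^ 4 / (b ^ α) ^ 2 := by
    rw [Real.rpow_sub hb, mul_comm 2 α, Real.rpow_mul hb.le]
    norm_cast
  calc 1 / (32 * C ^ 2) * b ^ (4 - 2 * α) * B.length
      = b ^ 4 * B.length / (32 * (C * b ^ α) ^ 2) := by
        rw [hsplit]
        field_simp
    _ ≤ hbar := by
        rw [div_le_iff₀ (by positivity)]
        linarith [le_of_mul_le_mul_right hmul hlength]

end IsRegularIsosceles

end Band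

end FEM

theorem corollary2p1_general (Ω : Set FEM.Plane) (hΩ : interior (closure Ω) ⊆ Ω) :
    ∃ C_L : ℝ → ℝ, (∀ C_u > 0, 0 < C_L C_u) ∧ Tendsto C_L (𝓝[>] 0) (𝓝 0) ∧
      ∀ α : ℝ, α ≤ 1 → ∀ C_u > 0,
        (∀ C_K : ℝ, ∃ C > 0, ∀ T : FEM.Triangulation Ω,
          (∃ U ∈ T.feSpace, FEM.h1Seminorm Ω (FEM.quadratic - U) ≤ C_u * T.meshSize ^ α) →
          ∀ N : ℕ, 1 ≤ N → ∀ B : FEM.Band T N, B.AreaComparable C_K →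
            C_L C_u * T.meshSize ^ (2 * α / 5) ≤ B.length →
            B.flatness * B.length * (N : ℝ) ^ (-(1 / 2) : ℝ) ≤ C * T.meshSize ^ α) ∧
        (∃ C > 0, ∀ T : FEM.Triangulation Ω,
          (∃ U ∈ T.feSpace, FEM.h1Seminorm Ω (FEM.quadratic - U) ≤ C_u * T.meshSize ^ α) →
          ∀ N : ℕ, 1 ≤ N → ∀ B : FEM.Band T N, ∀ hbar : ℝ,
            B.IsRegularIsosceles T.meshSize hbar →
            C_L C_u * T.meshSize ^ (2 * α / 5) ≤ B.length →
            C * T.meshSize ^ (4 - 2 * α) * B.length ≤ hbar) := by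
  obtain ⟨A, hA, hest⟩ := FEM.Band.exists_flatness_mul_length_le Ω
  refine ⟨fun s => A * s ^ (2 / 5 : ℝ), fun C_u hCu => by positivity, ?_,
    fun α hα C_u hCu => ⟨fun C_K => ?_, ?_⟩⟩
  · have hcont : ContinuousAt (fun s : ℝ => A * s ^ (2 / 5 : ℝ)) 0 :=
      (Real.continuousAt_rpow_const 0 (2 / 5) (.inr (by norm_num))).const_mul A
    simpa using hcont.tendsto.mono_left nhdsWithin_le_nhds
  · obtain ⟨C, hC, hband⟩ := hest α hα C_u hCu |C_K| (abs_nonneg _)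
    refine ⟨C, hC, fun T ⟨U, hU, herr⟩ N hN B hB hL => ?_⟩
    rw [← T.h1Seminorm_closure hΩ] at herr
    rw [Real.rpow_neg N.cast_nonneg, ← Real.sqrt_eq_rpow, ← div_eq_mul_inv,
      div_le_iff₀' (Real.sqrt_pos.2 (Nat.cast_pos.2 hN))]
    exact hband T U hU herr (hB.mono (le_abs_self _)) hL
  · obtain ⟨C, hC, hband⟩ := hest α hα C_u hCu 1 zero_le_one
    refine ⟨1 / (32 * C ^ 2), by positivity, fun T ⟨U, hU, herr⟩ N hN B hbar hB hL => ?_⟩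
    rw [← T.h1Seminorm_closure hΩ] at herr
    have : NeZero N := ⟨Nat.one_le_iff_ne_zero.1 hN⟩
    have hmesh := T.meshSize_pos (B.mem_K 0)
    exact hB.le_height hmesh hC (hband T U hU herr (hB.areaComparable_one hmesh.le) hL)

theorem corollary2p1 (Ω : Set FEM.Plane) (hΩ_open : IsOpen Ω) (hΩ_conn : IsConnected Ω)
    (hΩ_bdd : Bornology.IsBounded Ω) (hΩ_reg : interior (closure Ω) = Ω)
    (α : ℝ) (hα : α ∈ Set.Icc (0 : ℝ) 1) :
    -- the threshold `C_L` depends on `C(u)` (given `Ω`, `α`) and is small when `C(u)` is small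
    ∃ C_L : ℝ → ℝ, (∀ C_u > 0, 0 < C_L C_u) ∧
      Filter.Tendsto C_L (nhdsWithin 0 (Set.Ioi 0)) (nhds 0) ∧
      ∀ C_u > 0,
        (∀ C_K C_α : ℝ, ∃ C > 0, ∀ T : FEM.Triangulation Ω,
          (∃ U ∈ T.feSpace,
            FEM.h1Seminorm Ω (fun x => FEM.quadratic x - U x) ≤ C_u * T.meshSize ^ α) →
          ∀ N : ℕ, 1 ≤ N → ∀ B : FEM.Band T N,
            B.Comparable C_K C_α →
            C_L C_u * T.meshSize ^ (2 * α / 5) ≤ B.length →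
            (⨅ i : Fin N, 1 / Real.sin (Real.pi - B.alphaTilde i)) *
                (⨅ i : Fin N, √(FEM.area (B.Ktilde i))) * B.length * (N : ℝ) ^ (-(1 / 2) : ℝ)
              ≤ C * T.meshSize ^ α) ∧
        (∃ C > 0, ∀ T : FEM.Triangulation Ω,
          (∃ U ∈ T.feSpace,
            FEM.h1Seminorm Ω (fun x => FEM.quadratic x - U x) ≤ C_u * T.meshSize ^ α) →
          ∀ N : ℕ, 1 ≤ N → ∀ B : FEM.Band T N, ∀ hbar : ℝ,
            B.IsRegularIsosceles T.meshSize hbar →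
            C_L C_u * T.meshSize ^ (2 * α / 5) ≤ B.length →
            C * T.meshSize ^ (4 - 2 * α) * B.length ≤ hbar) := by
  obtain ⟨C_L, hpos, hlim, hC_L⟩ := corollary2p1_general Ω hΩ_reg.le
  refine ⟨C_L, hpos, hlim, fun C_u hCu => ⟨fun C_K _ => ?_, (hC_L α hα.2 C_u hCu).2⟩⟩
  obtain ⟨C, hC, hband⟩ := (hC_L α hα.2 C_u hCu).1 C_K
  exact ⟨C, hC, fun T hU N hN B hB => hband T hU N hN B hB.areaComparable⟩
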